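/- There is an absolute constant $C>0$ with the following property. Let $N,n\ge 1$ be integers. Let $U_1,\dots,U_n$ be i.i.d. random matrices uniformly (Haar) distributed on the unitary group $U(N)$. Let $Y_1,\dots,Y_n,Y'_1,\dots,Y'_n$ be i.i.d. random $N\times N$ matrices, each with entries $(2N)^{-1/2}(g_{rs}+\sqrt{-1}\,g'_{rs})$, where the $g_{rs},g'_{rs}$ $(1\le r,s\le N)$ are independent real $N(0,1)$ variables. For $x,y\in M_N(\mathbb C)$ let $x\otimes\bar y$ be the operator $\xi\mapsto x\xi y^*$ on $M_N(\mathbb C)$ equipped with the Hilbert–Schmidt norm, and let $P$ be the orthogonal projection of this Hilbert space onto the multiples of the identity matrix. For $1\le q\le\infty$ let $\|x\|_q=(\mathrm{tr}\,|x|^q)^{1/q}$ be the Schatten $q$-norm (the operator norm if $q=\infty$). Then for every real $p\ge 1$, every $1\le q\le\infty$ and all $a_1,\dots,a_n\in\mathbb C$, $$\mathbb E\Big\|\sum_{j=1}^n a_j\,(U_j\otimes\bar U_j)(1-P)\Big\|_q^p\le C^p\,\mathbb E\Big\|\sum_{j=1}^n a_j\,Y_j\otimes\bar Y'_j\Big\|_q^p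 ,$$ where both expectations are finite. More generally, with the same $C$, for every $k\ge 1$ and all $a_1,\dots,a_n\in M_k(\mathbb C)$, $$\mathbb E\Big\|\sum_{j=1}^n a_j\otimes\big((U_j\otimes\bar U_j)(1-P)\big)\Big\|_q^p\le C^p\,\mathbb E\Big\|\sum_{j=1}^n a_j\otimes Y_j\otimes\bar Y'_j\Big\|_q^p ,$$ again with both expectations finite. -/

import Mathlib

open MeasureTheory ProbabilityTheory
open scoped ENNReal Kronecker

noncomputable section

namespace RandomUnitary

/-- The Borel sigma-algebra on matrices. -/
instance instMeasurableSpaceMatrix {m n : Type*} : MeasurableSpace (Matrix m n ℂ) :=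
  borel (Matrix m n ℂ)

instance instBorelSpaceMatrix {m n : Type*} : BorelSpace (Matrix m n ℂ) := ⟨rfl⟩

instance instCompactSpaceUnitaryGroup (N : ℕ) :
    CompactSpace (Matrix.unitaryGroup (Fin N) ℂ) := by
  refine (isCompact_iff_compactSpace
    (s := (Matrix.unitaryGroup (Fin N) ℂ : Set (Matrix (Fin N) (Fin N) ℂ)))).mp ?_
  have hK : IsCompact (Set.pi Set.univ fun _ : Fin N =>
      Set.pi Set.univ fun _ : Fin N => Metric.closedBall (0 : ℂ) 1) :=
    isCompact_univ_pi fun _ => isCompact_univ_pi fun _ => isCompact_closedBall _ _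
  have hc : IsClosed ((Matrix.unitaryGroup (Fin N) ℂ : Set (Matrix (Fin N) (Fin N) ℂ))) := by
    have : ((Matrix.unitaryGroup (Fin N) ℂ : Set (Matrix (Fin N) (Fin N) ℂ)))
        = {A | A * star A = 1} := by
      ext A
      exact Matrix.mem_unitaryGroup_iff
    rw [this]
    exact isClosed_eq (by fun_prop) continuous_const
  refine IsCompact.of_isClosed_subset (X := Matrix (Fin N) (Fin N) ℂ) hK hc ?_
  intro A hA i _ j _
  simpa using entry_norm_bound_of_unitary hA i j

/-- The uniform distribution on the unitary group `U(N)`: the Haar measure of total mass one. -/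
def haarUnitary (N : ℕ) : Measure (Matrix.unitaryGroup (Fin N) ℂ) :=
  Measure.haarMeasure ⊤

/-- The law of the Gaussian random matrix `Y` whose entries are
`Y i j = (2N)^(-1/2) (g i j + √-1 g' i j)`, where all `g i j`, `g' i j` are independent standard
normal variables. -/
def gaussianMatrixLaw (N : ℕ) : Measure (Matrix (Fin N) (Fin N) ℂ) :=
  (Measure.pi fun _ : Fin N × Fin N => (gaussianReal 0 1).prod (gaussianReal 0 1)).map
    fun g => Matrix.of fun i j =>
      (((√(2 * (N : ℝ)))⁻¹ : ℝ) : ℂ) * (((g (i, j)).1 : ℂ) + Complex.I * ((g (i, j)).2 : ℂ))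

section Schatten

open scoped MatrixOrder

/-- The Schatten `q`-norm `‖x‖_q = (tr |x|^q)^(1/q)`, where `|x| = (x* x)^(1/2)`; for `q = ∞` it is
the operator norm on the Euclidean space. -/
def schattenNorm {m : Type*} [Fintype m] [DecidableEq m] (q : ℝ≥0∞) (x : Matrix m m ℂ) : ℝ :=
  if q = ∞ then ‖Matrix.toEuclideanCLM (n := m) (𝕜 := ℂ) x‖
  else (Matrix.trace (cfc (fun t : ℝ => t ^ q.toReal) (CFC.abs x))).re ^ (1 / q.toReal)

end Schatten

/-- `x ⊗ ȳ`, as a matrix indexed by pairs. A vector indexed by pairs is an element `ξ` of `S_2^N`,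
and `x ⊗ ȳ` acts on it as `ξ ↦ x ξ y*`. -/
def tensorConj {N : ℕ} (x y : Matrix (Fin N) (Fin N) ℂ) :
    Matrix (Fin N × Fin N) (Fin N × Fin N) ℂ :=
  x ⊗ₖ y.map star

/-- The identity matrix, as a vector of `S_2^N`. -/
def idVec (N : ℕ) : Fin N × Fin N → ℂ := fun r => (1 : Matrix (Fin N) (Fin N) ℂ) r.1 r.2

/-- The orthogonal projection of `S_2^N` onto the multiples of the identity,
`ξ ↦ N⁻¹ ⟨1, ξ⟩ 1 = N⁻¹ (tr ξ) 1`. -/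
def projId (N : ℕ) : Matrix (Fin N × Fin N) (Fin N × Fin N) ℂ :=
  (N : ℂ)⁻¹ • Matrix.vecMulVec (idVec N) (star (idVec N))

/-- `x ⊗ ȳ` acts on `S_2^N` as `ξ ↦ x ξ y*`. -/
theorem tensorConj_mulVec {N : ℕ} (x y ξ : Matrix (Fin N) (Fin N) ℂ) :
    (tensorConj x y).mulVec (fun r => ξ r.1 r.2) = fun r => (x * ξ * y.conjTranspose) r.1 r.2 := by
  ext ⟨i, i'⟩
  simp only [tensorConj, Matrix.mulVec, dotProduct, Fintype.sum_prod_type, Matrix.mul_apply,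
    Matrix.kroneckerMap_apply, Matrix.map_apply, Matrix.conjTranspose_apply, Finset.sum_mul]
  rw [Finset.sum_comm]
  exact Finset.sum_congr rfl fun _ _ => Finset.sum_congr rfl fun _ _ => by ring

/-- `P` maps `ξ` to `N⁻¹ (tr ξ) 1`. -/
theorem projId_mulVec {N : ℕ} (ξ : Matrix (Fin N) (Fin N) ℂ) :
    (projId N).mulVec (fun r => ξ r.1 r.2) =
      fun r => (((N : ℂ)⁻¹ * ξ.trace) • (1 : Matrix (Fin N) (Fin N) ℂ)) r.1 r.2 := by
  ext ⟨i, i'⟩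
  simp [projId, idVec, Matrix.mulVec, dotProduct, Fintype.sum_prod_type, Matrix.vecMulVec_apply,
    Matrix.one_apply, Matrix.trace, Finset.mul_sum]

end RandomUnitary

end

open RandomUnitary

noncomputable section

/-! ### Polar decomposition and singular values. -/

section Polar

variable {m : Type*} [Fintype m] [DecidableEq m]

/-! The comparison holds for every real seminorm `F` on `n`-tuples of matrices that does not
increase when all entries are multiplied on the right by `1 - P`. The Schatten norms of `∑ a j • x
j` and `∑ a j ⊗ x j` are of this kind, because multiplying by a projection is averaging over two
unitaries. Two applications of Jensen's inequality, joined by a rotation of Gaussian variables, give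
the constant `8 = 4 * 2`.

From unitaries to Gaussians: if `U` is Haar distributed and independent of the Gaussian matrix `Y`,
then `U|Y|` has the law of `Y` (`measurePreserving_unitary_mul_abs`). Averaging `(U|Y| ⊗ conj
(U|Y|))(1 - P)` over `Y` gives `(U ⊗ conj U) M (1 - P)`, where `M = E |Y| ⊗ conj |Y|`. Unitary
invariance of the law of `Y` makes `ξ ↦ E |Y| ξ |Y|` commute with unitary conjugations, so by a
Schur lemma (`Matrix.exists_scalar_on_traceless`) it is a scalar `c` on trace-zero matrices, that
is, on the range of `1 - P`. Comparing traces gives `c (N² - 1) = E |tr |Y||² - 1`. The elementary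
bound `t ≥ t² - (4/27) t⁴`, with `E tr Y*Y = N` and `E tr (Y*Y)² = 2N`, then forces `c ≥ 1/4` for `N
≥ 2` (`exists_meanAbs_mul_eq_real_smul`). By Jensen, replacing the unitaries by Gaussians costs at
most `4 ^ p` (`mul_integral_seminorm_haarTuple_le`).

From `Y ⊗ conj Y` to `Y ⊗ conj Y'`: since `E Y' ⊗ conj Y' = P` and `P (1 - P) = 0`, Jensen allows an
independent copy to be subtracted, so that `Y ⊗ conj Y - Y' ⊗ conj Y'` dominates. Rotating the pair
`(Y, Y')` by `π/4` preserves its law and turns this difference into `Y ⊗ conj Y' + Y' ⊗ conj Y`,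
whose two terms have equal moments under `F`. This costs `2 ^ p`
(`integral_seminorm_compress_diag_le`). -/

theorem norm_apply_eq_of_star_mul_self_eq {E : Type*} [NormedAddCommGroup E]
    [InnerProductSpace ℂ E] [CompleteSpace E] {f g : E →L[ℂ] E} (h : star f * f = star g * g)
    (x : E) : ‖f x‖ = ‖g x‖ := by
  have key : ∀ f : E →L[ℂ] E, inner ℂ ((star f * f) x) x = ((‖f x‖ ^ 2 : ℝ) : ℂ) := by
    intro f
    rw [ContinuousLinearMap.star_eq_adjoint, mul_apply_eq_comp,
      ContinuousLinearMap.adjoint_inner_left, inner_self_eq_norm_sq_to_K]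
    simp
  have h1 := key f
  rw [h, key g] at h1
  have h2 : ‖g x‖ ^ 2 = ‖f x‖ ^ 2 := Complex.ofReal_injective h1
  exact ((sq_eq_sq₀ (norm_nonneg _) (norm_nonneg _)).mp h2).symm

/-- Equal Gram matrices mean `‖A x‖ = ‖B x‖`, so `B x ↦ A x` is a well-defined isometry on the range
of `B`. In finite dimension it extends to an isometry of the whole space, which is unitary. No
invertibility is needed. -/
theorem Matrix.exists_unitary_mul_of_conjTranspose_mul_self_eq {A B : Matrix m m ℂ}
    (h : star A * A = star B * B) : ∃ w ∈ Matrix.unitaryGroup m ℂ, A = w * B := by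
  set fA := Matrix.toEuclideanCLM (n := m) (𝕜 := ℂ) A with hfA
  set fB := Matrix.toEuclideanCLM (n := m) (𝕜 := ℂ) B with hfB
  have hAB : star fA * fA = star fB * fB := by
    rw [hfA, hfB, ← map_star, ← map_star, ← map_mul, ← map_mul, h]
  have hnorm : ∀ x, ‖fA x‖ = ‖fB x‖ := norm_apply_eq_of_star_mul_self_eq hAB
  obtain ⟨g, hg⟩ := LinearMap.exists_rightInverse_of_surjective
    (fB : EuclideanSpace ℂ m →ₗ[ℂ] EuclideanSpace ℂ m).rangeRestrict
    (LinearMap.range_eq_top.mpr (LinearMap.surjective_rangeRestrict _))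
  have hg' : ∀ s, fB (g s) = (s : EuclideanSpace ℂ m) := fun s =>
    congrArg Subtype.val (LinearMap.congr_fun hg s)
  let L : LinearMap.range (fB : EuclideanSpace ℂ m →ₗ[ℂ] EuclideanSpace ℂ m) →ₗᵢ[ℂ]
      EuclideanSpace ℂ m :=
    { toLinearMap := (fA : EuclideanSpace ℂ m →ₗ[ℂ] EuclideanSpace ℂ m) ∘ₗ g
      norm_map' := fun s => by
        simp only [LinearMap.comp_apply, ContinuousLinearMap.coe_coe, hnorm, hg']
        rfl }
  let W := L.extend.toContinuousLinearMap
  have hW : ∀ x, W (fB x) = fA x := by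
    intro x
    have h1 : W (fB x) = L ⟨fB x, LinearMap.mem_range_self _ x⟩ := L.extend_apply ⟨fB x, _⟩
    rw [h1]
    change fA (g ⟨fB x, _⟩) = fA x
    rw [← sub_eq_zero, ← map_sub, ← norm_eq_zero, hnorm, map_sub, hg', sub_self, norm_zero]
  have hWu : star W * W = 1 := by
    rw [ContinuousLinearMap.star_eq_adjoint]
    exact (ContinuousLinearMap.norm_map_iff_adjoint_comp_self W).mp L.extend.norm_map
  obtain ⟨w, hw⟩ := EquivLike.surjective (Matrix.toEuclideanCLM (n := m) (𝕜 := ℂ)) W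
  refine ⟨w, ?_, ?_⟩
  · rw [Matrix.mem_unitaryGroup_iff']
    apply EquivLike.injective (Matrix.toEuclideanCLM (n := m) (𝕜 := ℂ))
    rw [map_mul, map_star, hw, hWu, map_one]
  · apply EquivLike.injective (Matrix.toEuclideanCLM (n := m) (𝕜 := ℂ))
    rw [map_mul, hw]
    ext1 x
    exact (hW x).symm

open scoped MatrixOrder ComplexOrder in
theorem Matrix.exists_unitary_mul_abs (x : Matrix m m ℂ) :
    ∃ w ∈ Matrix.unitaryGroup m ℂ, x = w * CFC.abs x := by
  refine Matrix.exists_unitary_mul_of_conjTranspose_mul_self_eq ?_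
  have h : IsSelfAdjoint (CFC.abs x) := (CFC.abs_nonneg x).isSelfAdjoint
  rw [h.star_eq, CFC.abs_mul_abs]

open scoped MatrixOrder ComplexOrder in
/-- A singular value decomposition, in which the functional calculus of `|x|` is visible. -/
theorem Matrix.exists_singularValues (x : Matrix m m ℂ) :
    ∃ u ∈ Matrix.unitaryGroup m ℂ, ∃ v ∈ Matrix.unitaryGroup m ℂ, ∃ s : m → ℝ, (∀ i, 0 ≤ s i) ∧
      x = u * Matrix.diagonal (fun i => (s i : ℂ)) * v ∧
      ∀ f : ℝ → ℝ, (Matrix.trace (cfc f (CFC.abs x))).re = ∑ i, f (s i) := by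
  obtain ⟨w, hw, hx⟩ := Matrix.exists_unitary_mul_abs x
  have hps : (CFC.abs x).PosSemidef := Matrix.nonneg_iff_posSemidef.mp (CFC.abs_nonneg x)
  set hH := hps.isHermitian
  refine ⟨w * hH.eigenvectorUnitary, mul_mem hw hH.eigenvectorUnitary.2,
    star (hH.eigenvectorUnitary : Matrix m m ℂ), (star hH.eigenvectorUnitary).2,
    hH.eigenvalues, hps.eigenvalues_nonneg, ?_, ?_⟩
  · conv_lhs => rw [hx, hH.spectral_theorem]
    simp [Unitary.conjStarAlgAut_apply, mul_assoc, Function.comp_def]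
  · intro f
    rw [hH.cfc_eq, Matrix.IsHermitian.cfc, Unitary.conjStarAlgAut_apply, Matrix.trace_mul_comm,
      ← mul_assoc]
    simp [Matrix.trace_diagonal]

theorem Matrix.sum_norm_sq_row_of_unitary {u : Matrix m m ℂ} (hu : u ∈ Matrix.unitaryGroup m ℂ)
    (i : m) : ∑ k, ‖u i k‖ ^ 2 = 1 := by
  have h := congrFun (congrFun (Matrix.mem_unitaryGroup_iff.mp hu) i) i
  simp only [Matrix.mul_apply, Matrix.star_apply, Matrix.one_apply_eq] at h
  have h2 : ∀ k, u i k * star (u i k) = ((‖u i k‖ ^ 2 : ℝ) : ℂ) := fun k => by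
    simpa using Complex.mul_conj' (u i k)
  simp only [h2] at h
  exact_mod_cast h

theorem Matrix.sum_norm_sq_col_of_unitary {u : Matrix m m ℂ} (hu : u ∈ Matrix.unitaryGroup m ℂ)
    (k : m) : ∑ i, ‖u i k‖ ^ 2 = 1 := by
  simpa using Matrix.sum_norm_sq_row_of_unitary (Unitary.star_mem hu) k

/-- This is `2ab ≤ a² + b²` applied to `‖u i k‖` and `‖v k i‖`. For unitary `u` and `v` the
resulting weights form a doubly stochastic matrix. -/
theorem Matrix.norm_diag_mul_diagonal_mul_le (u v : Matrix m m ℂ) {s : m → ℝ} (hs : ∀ i, 0 ≤ s i)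
    (i : m) : ‖(u * Matrix.diagonal (fun i => (s i : ℂ)) * v) i i‖ ≤
      ∑ k, ((‖u i k‖ ^ 2 + ‖v k i‖ ^ 2) / 2) * s k := by
  rw [Matrix.mul_apply]
  refine (norm_sum_le _ _).trans (Finset.sum_le_sum fun k _ => ?_)
  rw [Matrix.mul_diagonal, norm_mul, norm_mul, Complex.norm_real, Real.norm_of_nonneg (hs k)]
  nlinarith [hs k, mul_nonneg (hs k) (sq_nonneg (‖u i k‖ - ‖v k i‖))]

/-- Each diagonal entry is bounded by an average of singular values with doubly stochastic weights.
Row sums equal to one allow Jensen for `t ↦ t ^ q`; column sums equal to one then collapse the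
double sum. -/
theorem Matrix.sum_norm_diag_rpow_le {u v : Matrix m m ℂ} (hu : u ∈ Matrix.unitaryGroup m ℂ)
    (hv : v ∈ Matrix.unitaryGroup m ℂ) {s : m → ℝ} (hs : ∀ i, 0 ≤ s i) {q : ℝ} (hq : 1 ≤ q) :
    ∑ i, ‖(u * Matrix.diagonal (fun i => (s i : ℂ)) * v) i i‖ ^ q ≤ ∑ k, s k ^ q := by
  calc ∑ i, ‖(u * Matrix.diagonal (fun i => (s i : ℂ)) * v) i i‖ ^ q
      ≤ ∑ i, ∑ k, ((‖u i k‖ ^ 2 + ‖v k i‖ ^ 2) / 2) * s k ^ q := by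
        refine Finset.sum_le_sum fun i _ => ?_
        refine (Real.rpow_le_rpow (norm_nonneg _) (Matrix.norm_diag_mul_diagonal_mul_le u v hs i)
          (by linarith)).trans ?_
        refine Real.rpow_arith_mean_le_arith_mean_rpow _ _ _ (fun k _ => by positivity) ?_
          (fun k _ => hs k) hq
        rw [← Finset.sum_div, Finset.sum_add_distrib, Matrix.sum_norm_sq_row_of_unitary hu,
          Matrix.sum_norm_sq_col_of_unitary hv]
        norm_num
    _ = ∑ k, s k ^ q := by
        rw [Finset.sum_comm]
        refine Finset.sum_congr rfl fun k _ => ?_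
        rw [← Finset.sum_mul, ← Finset.sum_div, Finset.sum_add_distrib,
          Matrix.sum_norm_sq_col_of_unitary hu, Matrix.sum_norm_sq_row_of_unitary hv]
        norm_num

end Polar

namespace RandomUnitary

/-! ### Schatten norms as seminorms, and their behaviour under unitaries and projections. -/

section SchattenNorm

variable {m : Type*} [Fintype m]

/-- The `ℓ^q` norm of the diagonal of a matrix. -/
def diagLpNorm (q : ℝ) (x : Matrix m m ℂ) : ℝ := (∑ i, ‖x i i‖ ^ q) ^ (1 / q)

theorem diagLpNorm_add_le {q : ℝ} (hq : 1 ≤ q) (x y : Matrix m m ℂ) :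
    diagLpNorm q (x + y) ≤ diagLpNorm q x + diagLpNorm q y := by
  have h := Real.Lp_add_le_of_nonneg Finset.univ hq (f := fun i => ‖x i i‖)
    (g := fun i => ‖y i i‖) (fun _ _ => norm_nonneg _) (fun _ _ => norm_nonneg _)
  refine le_trans ?_ h
  unfold diagLpNorm
  gcongr with i
  exact norm_add_le _ _

theorem diagLpNorm_smul {q : ℝ} (hq : 1 ≤ q) (c : ℝ) (x : Matrix m m ℂ) :
    diagLpNorm q (c • x) = |c| * diagLpNorm q x := by
  unfold diagLpNorm
  simp only [Matrix.smul_apply, norm_smul, Real.norm_eq_abs]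
  simp only [Real.mul_rpow (abs_nonneg c) (norm_nonneg _), ← Finset.mul_sum]
  rw [Real.mul_rpow (by positivity) (Finset.sum_nonneg fun _ _ => by positivity),
    ← Real.rpow_mul (abs_nonneg c), mul_one_div_cancel (by linarith), Real.rpow_one]

variable [DecidableEq m]

theorem one_le_toReal {q : ℝ≥0∞} (hq : 1 ≤ q) (hq' : q ≠ ∞) : 1 ≤ q.toReal := by
  simpa using ENNReal.toReal_mono hq' hq

/-- With `exists_schattenNorm_eq_diagLpNorm`, this presents the Schatten norm for finite `q` as a
maximum, over unitary `u` and `v`, of the `ℓ^q` norm of the diagonal of `u * x * v`. The triangle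
inequality, homogeneity and unitary invariance are then inherited from `ℓ^q`. -/
theorem diagLpNorm_le_schattenNorm {q : ℝ≥0∞} (hq : 1 ≤ q) (hq' : q ≠ ∞) (x : Matrix m m ℂ)
    {u v : Matrix m m ℂ} (hu : u ∈ Matrix.unitaryGroup m ℂ) (hv : v ∈ Matrix.unitaryGroup m ℂ) :
    diagLpNorm q.toReal (u * x * v) ≤ schattenNorm q x := by
  obtain ⟨u', hu', v', hv', s, hs, hx, hf⟩ := Matrix.exists_singularValues x
  rw [schattenNorm, if_neg hq', hf, diagLpNorm]
  have h1 := one_le_toReal hq hq'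
  refine Real.rpow_le_rpow (Finset.sum_nonneg fun _ _ => by positivity) ?_ (by positivity)
  have h2 : u * x * v = (u * u') * Matrix.diagonal (fun i => (s i : ℂ)) * (v' * v) := by
    rw [hx]; simp only [mul_assoc]
  rw [h2]
  exact Matrix.sum_norm_diag_rpow_le (mul_mem hu hu') (mul_mem hv' hv) hs h1

theorem exists_schattenNorm_eq_diagLpNorm {q : ℝ≥0∞} (hq' : q ≠ ∞)
    (x : Matrix m m ℂ) : ∃ u ∈ Matrix.unitaryGroup m ℂ, ∃ v ∈ Matrix.unitaryGroup m ℂ,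
      schattenNorm q x = diagLpNorm q.toReal (u * x * v) := by
  obtain ⟨u, hu, v, hv, s, hs, hx, hf⟩ := Matrix.exists_singularValues x
  refine ⟨star u, Unitary.star_mem hu, star v, Unitary.star_mem hv, ?_⟩
  rw [schattenNorm, if_neg hq', hf, diagLpNorm]
  have h2 : star u * x * star v = Matrix.diagonal (fun i => (s i : ℂ)) := by
    rw [hx]
    calc _ = (star u * u) * Matrix.diagonal (fun i => (s i : ℂ)) * (v * star v) := by
          simp only [mul_assoc]
      _ = _ := by
          rw [Matrix.mem_unitaryGroup_iff'.mp hu, Matrix.mem_unitaryGroup_iff.mp hv, one_mul,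
            mul_one]
  rw [h2]
  simp [abs_of_nonneg (hs _)]

theorem schattenNorm_add_le {q : ℝ≥0∞} (hq : 1 ≤ q) (x y : Matrix m m ℂ) :
    schattenNorm q (x + y) ≤ schattenNorm q x + schattenNorm q y := by
  by_cases hq' : q = ∞
  · simp only [schattenNorm, if_pos hq', map_add]
    exact norm_add_le _ _
  · obtain ⟨u, hu, v, hv, h⟩ := exists_schattenNorm_eq_diagLpNorm hq' (x + y)
    rw [h, mul_add, add_mul]
    exact (diagLpNorm_add_le (one_le_toReal hq hq') _ _).trans
      (add_le_add (diagLpNorm_le_schattenNorm hq hq' x hu hv)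
        (diagLpNorm_le_schattenNorm hq hq' y hu hv))

theorem schattenNorm_smul_le {q : ℝ≥0∞} (hq : 1 ≤ q) (c : ℝ) (x : Matrix m m ℂ) :
    schattenNorm q (c • x) ≤ |c| * schattenNorm q x := by
  by_cases hq' : q = ∞
  · simp only [schattenNorm, if_pos hq']
    rw [← Complex.coe_smul c x, map_smul, norm_smul]
    simp
  · obtain ⟨u, hu, v, hv, h⟩ := exists_schattenNorm_eq_diagLpNorm hq' (c • x)
    rw [h, mul_smul_comm, smul_mul_assoc, diagLpNorm_smul (one_le_toReal hq hq')]
    exact mul_le_mul_of_nonneg_left (diagLpNorm_le_schattenNorm hq hq' x hu hv) (abs_nonneg c)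

theorem schattenNorm_zero {q : ℝ≥0∞} (hq : 1 ≤ q) :
    schattenNorm q (0 : Matrix m m ℂ) = 0 := by
  by_cases hq' : q = ∞
  · simp [schattenNorm, if_pos hq']
  · obtain ⟨u, hu, v, hv, h⟩ := exists_schattenNorm_eq_diagLpNorm hq' (0 : Matrix m m ℂ)
    have h1 := one_le_toReal hq hq'
    have h2 : q.toReal ≠ 0 := by linarith
    rw [h]
    simp [diagLpNorm, Real.zero_rpow h2, Real.zero_rpow (inv_ne_zero h2)]

theorem schattenNorm_mul_unitary_le {q : ℝ≥0∞} (hq : 1 ≤ q) (x : Matrix m m ℂ)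
    {w : Matrix m m ℂ} (hw : w ∈ Matrix.unitaryGroup m ℂ) :
    schattenNorm q (x * w) ≤ schattenNorm q x := by
  by_cases hq' : q = ∞
  · simp only [schattenNorm, if_pos hq', map_mul]
    refine (CStarRing.norm_mul_mem_unitary _ ?_).le
    exact Unitary.map_mem (Matrix.toEuclideanCLM (n := m) (𝕜 := ℂ)) hw
  · obtain ⟨u, hu, v, hv, h⟩ := exists_schattenNorm_eq_diagLpNorm hq' (x * w)
    rw [h, ← mul_assoc, mul_assoc]
    exact diagLpNorm_le_schattenNorm hq hq' x hu (mul_mem hw hv)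

/-- The Schatten `q`-norm as a real seminorm. -/
def schattenSeminorm (m : Type*) [Fintype m] [DecidableEq m] {q : ℝ≥0∞} (hq : 1 ≤ q) :
    Seminorm ℝ (Matrix m m ℂ) :=
  Seminorm.ofSMulLE (schattenNorm q) (schattenNorm_zero hq) (schattenNorm_add_le hq)
    (schattenNorm_smul_le hq)

/-- The reflection `2e - 1` is unitary and `x e` is the midpoint of `x` and `x (2e - 1)`. -/
theorem schattenNorm_mul_projection_le {q : ℝ≥0∞} (hq : 1 ≤ q) (x : Matrix m m ℂ)
    {e : Matrix m m ℂ} (he : star e = e) (hee : e * e = e) :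
    schattenNorm q (x * e) ≤ schattenNorm q x := by
  have hw : (2 : ℝ) • e - 1 ∈ Matrix.unitaryGroup m ℂ := by
    rw [Matrix.mem_unitaryGroup_iff, star_sub, star_smul, he, star_one]
    simp only [sub_mul, mul_sub, smul_mul_assoc, mul_smul_comm, hee, one_mul, mul_one, star_trivial]
    module
  have hx : x * e = (1 / 2 : ℝ) • x + (1 / 2 : ℝ) • (x * ((2 : ℝ) • e - 1)) := by
    rw [mul_sub, mul_smul_comm, mul_one]
    module
  rw [hx]
  refine (schattenNorm_add_le hq _ _).trans ?_
  have h1 := schattenNorm_smul_le hq (1 / 2) x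
  have h2 := schattenNorm_smul_le hq (1 / 2) (x * ((2 : ℝ) • e - 1))
  have h3 := schattenNorm_mul_unitary_le hq x hw
  rw [abs_of_nonneg (by norm_num)] at h1 h2
  linarith

end SchattenNorm

end RandomUnitary

/-! ### A Schur lemma for conjugation-equivariant maps on matrices. -/

section Schur

variable {ι : Type*} [Fintype ι] [DecidableEq ι]

theorem Matrix.one_add_smul_mem_unitaryGroup {q : Matrix ι ι ℂ} (hq : star q = q)
    (hqq : q * q = q) {θ : ℂ} (hθ : θ * star θ = 1) :
    1 + (θ - 1) • q ∈ Matrix.unitaryGroup ι ℂ := by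
  rw [Matrix.mem_unitaryGroup_iff]
  simp only [star_add, star_one, star_smul, hq, add_mul, mul_add, one_mul, mul_one, smul_mul_assoc,
    mul_smul_comm, hqq, star_sub]
  have : (1 : Matrix ι ι ℂ) + (θ - 1) • q + (star θ - 1) • (q + (θ - 1) • q)
      = 1 + (θ * star θ - 1) • q := by module
  rw [this, hθ]
  simp

variable {Φ : Matrix ι ι ℂ →ₗ[ℂ] Matrix ι ι ℂ}

/-- A linear map that is equivariant under unitary conjugation commutes with the commutator by a
projection. -/
theorem Matrix.map_commutator_projection
    (hΦ : ∀ V ∈ Matrix.unitaryGroup ι ℂ, ∀ ξ, Φ (V * ξ * star V) = V * Φ ξ * star V)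
    {q : Matrix ι ι ℂ} (hq : star q = q) (hqq : q * q = q) (ξ : Matrix ι ι ℂ) :
    Φ (q * ξ - ξ * q) = q * Φ ξ - Φ ξ * q := by
  have hI : Complex.I * star Complex.I = 1 := by simp
  have hI' : (-Complex.I) * star (-Complex.I) = 1 := by simp
  have h1 := hΦ _ (Matrix.one_add_smul_mem_unitaryGroup hq hqq hI) ξ
  have h2 := hΦ _ (Matrix.one_add_smul_mem_unitaryGroup hq hqq hI') ξ
  -- Conjugation by `1 + (θ - 1) q` has a quadratic term `|θ - 1|² q η q`, which is the same for `θ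
  -- = I` and `θ = -I`. The difference leaves only the commutator.
  have key : ∀ η : Matrix ι ι ℂ, (1 + (Complex.I - 1) • q) * η * star (1 + (Complex.I - 1) • q)
      - (1 + (-Complex.I - 1) • q) * η * star (1 + (-Complex.I - 1) • q)
      = (2 * Complex.I) • (q * η - η * q) := by
    intro η
    simp only [star_add, star_one, star_smul, hq, add_mul, mul_add, one_mul, mul_one,
      smul_mul_assoc, mul_smul_comm, star_sub, star_neg, RCLike.star_def, Complex.conj_I]
    module
  have h3 := key ξ
  apply_fun Φ at h3
  rw [map_sub, h1, h2, key, map_smul] at h3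
  exact (smul_right_injective _ (by simp : (2 * Complex.I) ≠ 0) h3).symm

/-- Matrix units are complex linear combinations of projections. For `|θ| = 1` the matrix `s = θ
e_ij + conj θ e_ji` is an involution on the span of the two basis vectors, so `(d + s) / 2` is a
projection with `d = e_ii + e_jj`. The choices `θ = 1` and `θ = I` recover `e_ij`. -/
theorem Matrix.map_commutator_single
    (hΦ : ∀ V ∈ Matrix.unitaryGroup ι ℂ, ∀ ξ, Φ (V * ξ * star V) = V * Φ ξ * star V)
    (i j : ι) (ξ : Matrix ι ι ℂ) :
    Φ (Matrix.single i j 1 * ξ - ξ * Matrix.single i j 1)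
      = Matrix.single i j 1 * Φ ξ - Φ ξ * Matrix.single i j 1 := by
  have hdiag : ∀ i : ι, Φ (Matrix.single i i 1 * ξ - ξ * Matrix.single i i 1)
      = Matrix.single i i 1 * Φ ξ - Φ ξ * Matrix.single i i 1 := fun i =>
    Matrix.map_commutator_projection hΦ (by simp [Matrix.star_eq_conjTranspose])
      (by simp) ξ
  rcases eq_or_ne i j with rfl | hij
  · exact hdiag i
  have hstar : ∀ a b : ι, star (Matrix.single a b (1 : ℂ)) = Matrix.single b a 1 := fun a b => by
    simp [Matrix.star_eq_conjTranspose]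
  have hproj : ∀ θ : ℂ, θ * star θ = 1 →
      Φ ((θ • Matrix.single i j 1 + star θ • Matrix.single j i 1) * ξ
        - ξ * (θ • Matrix.single i j 1 + star θ • Matrix.single j i 1))
      = (θ • Matrix.single i j 1 + star θ • Matrix.single j i 1) * Φ ξ
        - Φ ξ * (θ • Matrix.single i j 1 + star θ • Matrix.single j i 1) := by
    intro θ hθ
    have hθ' : star θ * θ = 1 := by rw [mul_comm]; exact hθ
    set s : Matrix ι ι ℂ := θ • Matrix.single i j 1 + star θ • Matrix.single j i 1 with hs
    set d : Matrix ι ι ℂ := Matrix.single i i 1 + Matrix.single j j 1 with hd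
    have hdd : d * d = d := by
      simp [hd, add_mul, mul_add, Matrix.single_mul_single_of_ne, hij, hij.symm]
    have hds : d * s = s := by
      simp [hd, hs, add_mul, mul_add, Matrix.single_mul_single_of_ne, hij, hij.symm,
        -Matrix.smul_single]
      try abel
    have hsd : s * d = s := by
      simp [hd, hs, add_mul, mul_add, Matrix.single_mul_single_of_ne, hij, hij.symm,
        -Matrix.smul_single]
      try abel
    have hss : s * s = d := by
      simp only [hs, add_mul, mul_add, smul_mul_assoc, mul_smul_comm,
        Matrix.single_mul_single_same, mul_one, smul_smul, hθ, hθ',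
        Matrix.single_mul_single_of_ne _ _ _ _ hij,
        Matrix.single_mul_single_of_ne _ _ _ _ hij.symm, smul_zero, zero_add, add_zero, one_smul, hd]
      try abel
    have h := Matrix.map_commutator_projection hΦ (q := (1 / 2 : ℂ) • (d + s)) (by
      simp only [hd, hs, star_smul, star_add, hstar, star_star]
      simp
      abel) (by
      simp only [smul_mul_assoc, mul_smul_comm, add_mul, mul_add, hdd, hds, hsd, hss]
      module) ξ
    have hd' : Φ (d * ξ - ξ * d) = d * Φ ξ - Φ ξ * d := by
      have := congrArg₂ (· + ·) (hdiag i) (hdiag j)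
      simp only [← map_add] at this
      rw [hd]
      convert this using 1
      · congr 1; noncomm_ring
      · noncomm_ring
    have e1 : ∀ η : Matrix ι ι ℂ, s * η - η * s
        = (2 : ℂ) • ((1 / 2 : ℂ) • (d + s) * η - η * (1 / 2 : ℂ) • (d + s)) - (d * η - η * d) := by
      intro η
      simp only [smul_mul_assoc, mul_smul_comm, add_mul, mul_add]
      module
    rw [e1, map_sub, map_smul, h, hd', e1]
  have h1 := hproj 1 (by simp)
  have h2 := hproj Complex.I (by simp)
  set s1 : Matrix ι ι ℂ := (1 : ℂ) • Matrix.single i j 1 + star (1 : ℂ) • Matrix.single j i 1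
  set s2 : Matrix ι ι ℂ := Complex.I • Matrix.single i j 1 + star Complex.I • Matrix.single j i 1
  have hsingle : Matrix.single i j (1 : ℂ) = (1 / 2 : ℂ) • (s1 - Complex.I • s2) := by
    simp only [s1, s2, smul_add, smul_sub, smul_smul, star_one, RCLike.star_def, Complex.conj_I]
    have : Complex.I * -Complex.I = 1 := by simp
    rw [this, Complex.I_mul_I]
    module
  have e1 : ∀ η : Matrix ι ι ℂ, Matrix.single i j (1 : ℂ) * η - η * Matrix.single i j (1 : ℂ)
      = (1 / 2 : ℂ) • ((s1 * η - η * s1) - Complex.I • (s2 * η - η * s2)) := by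
    intro η
    rw [hsingle]
    simp only [smul_mul_assoc, mul_smul_comm, sub_mul, mul_sub]
    module
  rw [e1, map_smul, map_sub, map_smul, h1, h2, e1]

/-- A weight-space argument: `e_ij` has eigenvalue `1` for the commutator with `e_ii` and `-1` for
that with `e_jj`. Its image under `Φ` has the same eigenvalues, and only multiples of `e_ij` do. -/
theorem Matrix.exists_map_single_eq_smul
    (hΦ : ∀ i j ξ, Φ (Matrix.single i j 1 * ξ - ξ * Matrix.single i j 1)
      = Matrix.single i j 1 * Φ ξ - Φ ξ * Matrix.single i j 1) {i j : ι} (hij : i ≠ j) :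
    ∃ c : ℂ, Φ (Matrix.single i j 1) = c • Matrix.single i j 1 := by
  set Y := Φ (Matrix.single i j 1) with hY
  have h1 : Matrix.single i i 1 * Y - Y * Matrix.single i i 1 = Y := by
    rw [hY, ← hΦ]
    simp [Matrix.single_mul_single_of_ne _ _ _ _ hij.symm]
  have h2 : Matrix.single j j 1 * Y - Y * Matrix.single j j 1 = -Y := by
    rw [hY, ← hΦ]
    simp [Matrix.single_mul_single_of_ne _ _ _ _ hij.symm]
  have hl : ∀ a k l : ι, (Matrix.single a a (1 : ℂ) * Y) k l = if k = a then Y k l else 0 := by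
    intro a k l
    split_ifs with h
    · subst h; simp
    · simp [h]
  have hr : ∀ a k l : ι, (Y * Matrix.single a a (1 : ℂ)) k l = if l = a then Y k l else 0 := by
    intro a k l
    split_ifs with h
    · subst h; simp
    · simp [h]
  refine ⟨Y i j, ?_⟩
  ext k l
  have h1' := congrArg (fun A : Matrix ι ι ℂ => A k l) h1
  have h2' := congrArg (fun A : Matrix ι ι ℂ => A k l) h2
  simp only [Matrix.sub_apply, Matrix.neg_apply, hl, hr] at h1' h2'
  rw [Matrix.smul_apply, Matrix.single_apply]
  by_cases hk : k = i
  · by_cases hlj : l = j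
    · simp [hk, hlj]
    · rw [if_neg (fun h => hlj h.2.symm), smul_zero]
      rw [if_neg hlj, if_neg (fun h : k = j => hij (hk.symm.trans h))] at h2'
      simpa using h2'
  · rw [if_neg (fun h => hk h.1.symm), smul_zero]
    rw [if_neg hk] at h1'
    split_ifs at h1'
    · linear_combination (-1 / 2 : ℂ) * h1'
    · simpa using h1'.symm

/-- A linear map on matrices that is equivariant under unitary conjugation is a scalar on the
matrices of trace zero. -/
theorem Matrix.exists_scalar_on_traceless [Nontrivial ι]
    (hΦ : ∀ V ∈ Matrix.unitaryGroup ι ℂ, ∀ ξ, Φ (V * ξ * star V) = V * Φ ξ * star V) :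
    ∃ c : ℂ, ∀ ξ : Matrix ι ι ℂ, ξ.trace = 0 → Φ ξ = c • ξ := by
  have hb := Matrix.map_commutator_single hΦ
  obtain ⟨i, j, hij⟩ := exists_pair_ne ι
  obtain ⟨c, hc⟩ := Matrix.exists_map_single_eq_smul hb hij
  refine ⟨c, ?_⟩
  -- The eigenspace `L` is stable under brackets with matrix units and contains one off-diagonal
  -- unit. Brackets generate from it all off-diagonal units and all differences of diagonal units,
  -- which span the trace-zero matrices.
  let L : Submodule ℂ (Matrix ι ι ℂ) := LinearMap.eqLocus Φ (c • LinearMap.id)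
  have hL : ∀ ξ, ξ ∈ L ↔ Φ ξ = c • ξ := fun ξ => Iff.rfl
  have hbr : ∀ a b ξ, ξ ∈ L → Matrix.single a b 1 * ξ - ξ * Matrix.single a b 1 ∈ L := by
    intro a b ξ h
    rw [hL] at h ⊢
    rw [hb, h, mul_smul_comm, smul_mul_assoc, smul_sub]
  have h0 : Matrix.single i j (1 : ℂ) ∈ L := hc
  have h1 : ∀ k, k ≠ j → Matrix.single k j (1 : ℂ) ∈ L := by
    intro k hk
    simpa [Matrix.single_mul_single_of_ne _ _ _ _ hk.symm] using hbr k i _ h0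
  have h2 : ∀ k l, k ≠ j → l ≠ k → Matrix.single k l (1 : ℂ) ∈ L := by
    intro k l hk hl
    simpa [Matrix.single_mul_single_of_ne _ _ _ _ hl] using neg_mem (hbr j l _ (h1 k hk))
  have h3 : ∀ k, k ≠ j → Matrix.single k k (1 : ℂ) - Matrix.single j j 1 ∈ L := by
    intro k hk
    simpa using neg_mem (hbr j k _ (h1 k hk))
  have h4 : ∀ l, l ≠ j → Matrix.single j l (1 : ℂ) ∈ L := by
    intro l hl
    have h := hbr j l _ (h3 l hl)
    have e : Matrix.single j l (1 : ℂ) * (Matrix.single l l 1 - Matrix.single j j 1)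
        - (Matrix.single l l 1 - Matrix.single j j 1) * Matrix.single j l 1
        = (2 : ℂ) • Matrix.single j l (1 : ℂ) := by
      simp only [mul_sub, sub_mul, Matrix.single_mul_single_same, mul_one,
        Matrix.single_mul_single_of_ne _ _ _ _ hl]
      module
    rw [e] at h
    simpa [smul_smul] using L.smul_mem (1 / 2 : ℂ) h
  have h5 : ∀ k l, Matrix.single k l (1 : ℂ)
      - (if k = l then Matrix.single j j (1 : ℂ) else 0) ∈ L := by
    intro k l
    rcases eq_or_ne k l with rfl | hkl
    · rw [if_pos rfl]
      rcases eq_or_ne k j with rfl | hk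
      · simp
      · exact h3 k hk
    · rw [if_neg hkl, sub_zero]
      rcases eq_or_ne k j with rfl | hk
      · exact h4 l hkl.symm
      · exact h2 k l hk hkl.symm
  intro ξ hξ
  rw [← hL]
  have e : ξ = ∑ k, ∑ l, ξ k l • (Matrix.single k l (1 : ℂ)
      - (if k = l then Matrix.single j j (1 : ℂ) else 0)) := by
    have e1 : ∑ k, ∑ l, ξ k l • (if k = l then Matrix.single j j (1 : ℂ) else 0) = 0 := by
      simp only [smul_ite, smul_zero, Finset.sum_ite_eq, Finset.mem_univ, if_true]
      rw [← Finset.sum_smul]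
      have : ∑ k, ξ k k = 0 := hξ
      rw [this, zero_smul]
    simp only [smul_sub, Finset.sum_sub_distrib, e1, sub_zero]
    conv_lhs => rw [Matrix.matrix_eq_sum_single ξ]
    simp
  rw [e]
  exact sum_mem fun k _ => sum_mem fun l _ => L.smul_mem _ (h5 k l)

end Schur

namespace RandomUnitary

/-! ### Complex Gaussian vectors and their invariance under isometries. -/

section ComplexGaussian

theorem map_prod_gaussianReal_eq_stdGaussian :
    ((gaussianReal 0 1).prod (gaussianReal 0 1)).map
      (fun p : ℝ × ℝ => (p.1 : ℂ) + Complex.I * (p.2 : ℂ)) = stdGaussian ℂ := by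
  rw [stdGaussian_eq_map_pi_orthonormalBasis Complex.orthonormalBasisOneI,
    ← (measurePreserving_piFinTwo fun _ : Fin 2 => gaussianReal 0 1).map_eq,
    Measure.map_map (by fun_prop) (by fun_prop)]
  congr 1
  ext x
  simp [mul_comm]

variable (ι : Type*) [Fintype ι]

/-- The law of a family of independent standard complex Gaussian variables. -/
def complexGaussian : Measure (ι → ℂ) := Measure.pi fun _ => stdGaussian ℂ

instance : IsProbabilityMeasure (complexGaussian ι) := by
  unfold complexGaussian; infer_instance

theorem map_complexGaussian_eq_stdGaussian :
    (complexGaussian ι).map (WithLp.toLp 2) = stdGaussian (PiLp 2 fun _ : ι => ℂ) := by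
  apply Measure.ext_of_charFun (E := PiLp 2 fun _ : ι => ℂ)
  ext t
  rw [complexGaussian, charFun_pi]
  simp_rw [charFun_stdGaussian, ← Complex.exp_sum, ← Complex.ofReal_pow, PiLp.norm_sq_eq_of_L2]
  simp [Finset.sum_div, neg_div]

variable {ι}

/-- On the Euclidean space the law is the standard Gaussian, which every linear isometry preserves.
Real linearity suffices. -/
theorem measurePreserving_complexGaussian (L : (ι → ℂ) →ₗ[ℝ] (ι → ℂ))
    (hL : ∀ z, ∑ i, ‖L z i‖ ^ 2 = ∑ i, ‖z i‖ ^ 2) :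
    MeasurePreserving L (complexGaussian ι) (complexGaussian ι) := by
  let f : (PiLp 2 fun _ : ι => ℂ) →ₗᵢ[ℝ] (PiLp 2 fun _ : ι => ℂ) :=
    { toLinearMap := (WithLp.linearEquiv 2 ℝ (ι → ℂ)).symm.toLinearMap ∘ₗ L ∘ₗ
        (WithLp.linearEquiv 2 ℝ (ι → ℂ)).toLinearMap
      norm_map' := fun x => by
        rw [← sq_eq_sq₀ (norm_nonneg _) (norm_nonneg _), PiLp.norm_sq_eq_of_L2,
          PiLp.norm_sq_eq_of_L2]
        exact hL _ }
  let e := f.toLinearIsometryEquiv rfl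
  have hcont : Measurable L := (LinearMap.continuous_of_finiteDimensional L).measurable
  refine ⟨hcont, ?_⟩
  have h1 : (complexGaussian ι).map (WithLp.toLp 2) = ((complexGaussian ι).map L).map
      (WithLp.toLp 2) := by
    have h2 := stdGaussian_map e
    rw [← map_complexGaussian_eq_stdGaussian, Measure.map_map (by fun_prop) (by fun_prop)] at h2
    rw [Measure.map_map (by fun_prop) hcont, ← h2]
    rfl
  exact ((MeasurableEquiv.toLp 2 (ι → ℂ)).map_measurableEquiv_injective h1).symm

end ComplexGaussian

/-! ### The Gaussian matrix law and its unitary invariance. -/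

section GaussianMatrix

variable {N : ℕ}

instance : SecondCountableTopology (Matrix (Fin N) (Fin N) ℂ) :=
  inferInstanceAs (SecondCountableTopology (Fin N → Fin N → ℂ))

/-- The matrix with entries `(2N)^(-1/2) z i j`. -/
def scaledMatrix (N : ℕ) (z : Fin N × Fin N → ℂ) : Matrix (Fin N) (Fin N) ℂ :=
  Matrix.of fun i j => (((√(2 * (N : ℝ)))⁻¹ : ℝ) : ℂ) * z (i, j)

theorem continuous_scaledMatrix : Continuous (scaledMatrix N) := by
  refine continuous_pi fun i => continuous_pi fun j => ?_
  simp only [scaledMatrix, Matrix.of_apply]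
  fun_prop

theorem gaussianMatrixLaw_eq_map :
    gaussianMatrixLaw N = (complexGaussian (Fin N × Fin N)).map (scaledMatrix N) := by
  have h : complexGaussian (Fin N × Fin N) =
      (Measure.pi fun _ : Fin N × Fin N => (gaussianReal 0 1).prod (gaussianReal 0 1)).map
        (fun g i => ((g i).1 : ℂ) + Complex.I * ((g i).2 : ℂ)) := by
    have := Measure.pi_map_pi (μ := fun _ : Fin N × Fin N =>
      (gaussianReal 0 1).prod (gaussianReal 0 1))
      (f := fun _ p => ((p.1 : ℝ) : ℂ) + Complex.I * ((p.2 : ℝ) : ℂ))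
      (fun i => Measurable.aemeasurable (by fun_prop))
    rw [this, complexGaussian, map_prod_gaussianReal_eq_stdGaussian]
  rw [h, Measure.map_map continuous_scaledMatrix.measurable (by fun_prop)]
  rfl

instance : IsProbabilityMeasure (gaussianMatrixLaw N) := by
  rw [gaussianMatrixLaw_eq_map]
  exact Measure.isProbabilityMeasure_map continuous_scaledMatrix.measurable.aemeasurable

theorem measurePreserving_gaussianMatrixLaw
    (A : Matrix (Fin N) (Fin N) ℂ →ₗ[ℝ] Matrix (Fin N) (Fin N) ℂ)
    (hA : ∀ Y, ∑ i, ∑ j, ‖A Y i j‖ ^ 2 = ∑ i, ∑ j, ‖Y i j‖ ^ 2) :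
    MeasurePreserving A (gaussianMatrixLaw N) (gaussianMatrixLaw N) := by
  let L : (Fin N × Fin N → ℂ) →ₗ[ℝ] (Fin N × Fin N → ℂ) :=
    { toFun := fun z r => A (Matrix.of fun i j => z (i, j)) r.1 r.2
      map_add' := fun z w => by
        ext r
        have : (Matrix.of fun i j => (z + w) (i, j))
            = (Matrix.of fun i j => z (i, j)) + (Matrix.of fun i j => w (i, j)) := rfl
        rw [this, map_add]
        rfl
      map_smul' := fun c z => by
        ext r
        have : (Matrix.of fun i j => (c • z) (i, j)) = c • (Matrix.of fun i j => z (i, j)) := rfl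
        rw [this, map_smul]
        rfl }
  have hL := measurePreserving_complexGaussian L (fun z => by
    rw [Fintype.sum_prod_type, Fintype.sum_prod_type]
    exact hA _)
  have hAc : Measurable A := (LinearMap.continuous_of_finiteDimensional A).measurable
  have hSL : A ∘ scaledMatrix N = scaledMatrix N ∘ L := by
    ext z i j
    have h1 : scaledMatrix N z = ((√(2 * (N : ℝ)))⁻¹ : ℝ) • Matrix.of fun i j => z (i, j) := by
      ext i j
      simp [scaledMatrix]
    rw [Function.comp_apply, Function.comp_apply, h1, map_smul]
    simp [scaledMatrix, L]
  refine ⟨hAc, ?_⟩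
  rw [gaussianMatrixLaw_eq_map, Measure.map_map hAc continuous_scaledMatrix.measurable, hSL,
    ← Measure.map_map continuous_scaledMatrix.measurable hL.measurable, hL.map_eq]

theorem sum_norm_sq_eq_trace (Y : Matrix (Fin N) (Fin N) ℂ) :
    ∑ i, ∑ j, ‖Y i j‖ ^ 2 = (Matrix.trace (star Y * Y)).re := by
  rw [Finset.sum_comm]
  simp only [Matrix.trace, Matrix.diag_apply, Matrix.mul_apply, Matrix.star_apply, Complex.re_sum]
  refine Finset.sum_congr rfl fun i _ => Finset.sum_congr rfl fun j _ => ?_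
  rw [RCLike.star_def, Complex.conj_mul', ← Complex.ofReal_pow, Complex.ofReal_re]

theorem measurePreserving_unitary_mul {V W : Matrix (Fin N) (Fin N) ℂ}
    (hV : V ∈ Matrix.unitaryGroup (Fin N) ℂ) (hW : W ∈ Matrix.unitaryGroup (Fin N) ℂ) :
    MeasurePreserving (fun Y => V * Y * W) (gaussianMatrixLaw N) (gaussianMatrixLaw N) := by
  refine measurePreserving_gaussianMatrixLaw
    ((LinearMap.mulRight ℝ W) ∘ₗ (LinearMap.mulLeft ℝ V)) (fun Y => ?_)
  rw [sum_norm_sq_eq_trace, sum_norm_sq_eq_trace]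
  simp only [LinearMap.comp_apply, LinearMap.mulLeft_apply, LinearMap.mulRight_apply, star_mul]
  have h : star W * (star Y * star V) * (V * Y * W) = star W * (star Y * (star V * V) * Y * W) := by
    simp only [mul_assoc]
  rw [h, Matrix.mem_unitaryGroup_iff'.mp hV, mul_one, Matrix.trace_mul_comm, mul_assoc,
    Matrix.mem_unitaryGroup_iff.mp hW, mul_one]

end GaussianMatrix

/-! ### Second and fourth moments of Gaussian variables. -/

section Moments

theorem integrable_pow_gaussianReal (k : ℕ) : Integrable (fun x : ℝ => x ^ k) (gaussianReal 0 1) := by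
  rcases Nat.eq_zero_or_pos k with rfl | hk
  · simp
  have h := (memLp_id_gaussianReal (μ := 0) (v := 1) (k : NNReal)).integrable_norm_rpow
    (by exact_mod_cast hk.ne') (by simp)
  refine h.mono' (by fun_prop) (Filter.Eventually.of_forall fun x => ?_)
  simp [norm_pow]

theorem integral_sq_gaussianReal : ∫ x, x ^ 2 ∂(gaussianReal 0 1) = 1 := by
  have h := variance_eq_sub (μ := gaussianReal 0 1) (X := id) (memLp_id_gaussianReal 2)
  rw [variance_id_gaussianReal] at h
  simpa using h.symm

/-- Rotation invariance determines the moment `m`: expanding `E ((x + y) / √2) ^ 4 = m` for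
independent `x` and `y` gives `m = (2m + 6) / 4`. -/
theorem integral_pow_four_gaussianReal : ∫ x, x ^ 4 ∂(gaussianReal 0 1) = 3 := by
  set μ := gaussianReal 0 1 with hμ
  have hrot := IsGaussian.map_rotation_eq_self (μ := μ) (by simp [hμ]) (Real.pi / 4)
  have h1 : ∫ p : ℝ × ℝ, p.1 ^ 4 ∂(μ.prod μ) = ∫ x, x ^ 4 ∂μ := by
    simpa using integral_fun_fst (μ := μ) (ν := μ) (fun x : ℝ => x ^ 4)
  have h2 : ∫ p : ℝ × ℝ, p.1 ^ 4 ∂(μ.prod μ)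
      = ∫ p : ℝ × ℝ, (1 / 4 : ℝ) * (p.1 ^ 4 * p.2 ^ 0 + 4 * (p.1 ^ 3 * p.2 ^ 1)
        + 6 * (p.1 ^ 2 * p.2 ^ 2) + 4 * (p.1 ^ 1 * p.2 ^ 3) + p.1 ^ 0 * p.2 ^ 4) ∂(μ.prod μ) := by
    conv_lhs => rw [← hrot]
    rw [integral_map (by fun_prop) (by fun_prop)]
    refine integral_congr_ae (Filter.Eventually.of_forall fun p => ?_)
    simp only [ContinuousLinearMap.rotation_apply, Real.cos_pi_div_four, Real.sin_pi_div_four,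
      smul_eq_mul]
    have h4 : √2 ^ 4 = (4 : ℝ) := by
      rw [show √2 ^ 4 = (√2 ^ 2) ^ 2 by ring, Real.sq_sqrt (by norm_num)]; norm_num
    have : (√2 / 2 * p.1 + √2 / 2 * p.2) ^ 4 = √2 ^ 4 / 16 * (p.1 + p.2) ^ 4 := by ring
    rw [this, h4]
    ring
  have hi : ∀ a b : ℕ, Integrable (fun p : ℝ × ℝ => p.1 ^ a * p.2 ^ b) (μ.prod μ) := fun a b =>
    (integrable_pow_gaussianReal a).mul_prod (integrable_pow_gaussianReal b)
  have hv : ∀ a b : ℕ, ∫ p : ℝ × ℝ, p.1 ^ a * p.2 ^ b ∂(μ.prod μ)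
      = (∫ x, x ^ a ∂μ) * ∫ x, x ^ b ∂μ := fun a b =>
    integral_prod_mul (fun x : ℝ => x ^ a) (fun x : ℝ => x ^ b)
  have h0 : ∫ x, x ^ 0 ∂μ = 1 := by simp
  have h01 : ∫ x, x ^ 1 ∂μ = 0 := by simp [hμ]
  have h02 : ∫ x, x ^ 2 ∂μ = 1 := integral_sq_gaussianReal
  rw [integral_const_mul, integral_add (by fun_prop) (by fun_prop),
    integral_add (by fun_prop) (by fun_prop), integral_add (by fun_prop) (by fun_prop),
    integral_add (by fun_prop) (by fun_prop), integral_const_mul, integral_const_mul,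
    integral_const_mul, hv, hv, hv, hv, hv, h0, h01, h02, h1] at h2
  linarith

theorem integral_stdGaussian_complex (f : ℂ → ℝ) (hf : Continuous f) :
    ∫ z, f z ∂(stdGaussian ℂ) = ∫ p : ℝ × ℝ, f ((p.1 : ℂ) + Complex.I * (p.2 : ℂ))
      ∂((gaussianReal 0 1).prod (gaussianReal 0 1)) := by
  rw [← map_prod_gaussianReal_eq_stdGaussian, integral_map (by fun_prop)
    hf.aestronglyMeasurable]

theorem norm_sq_add_I_mul (x y : ℝ) : ‖(x : ℂ) + Complex.I * (y : ℂ)‖ ^ 2 = x ^ 2 + y ^ 2 := by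
  rw [← Complex.normSq_eq_norm_sq, mul_comm, Complex.normSq_add_mul_I]

theorem integral_norm_sq_stdGaussian : ∫ z, ‖z‖ ^ 2 ∂(stdGaussian ℂ) = 2 := by
  rw [integral_stdGaussian_complex _ (by fun_prop)]
  simp only [norm_sq_add_I_mul]
  have h := integrable_pow_gaussianReal 2
  rw [integral_add (h.comp_fst _) (h.comp_snd _), integral_fun_fst (fun x : ℝ => x ^ 2),
    integral_fun_snd (fun x : ℝ => x ^ 2), integral_sq_gaussianReal]
  norm_num

theorem integral_norm_pow_four_stdGaussian : ∫ z, ‖z‖ ^ 4 ∂(stdGaussian ℂ) = 8 := by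
  rw [integral_stdGaussian_complex _ (by fun_prop)]
  have h : ∀ p : ℝ × ℝ, ‖(p.1 : ℂ) + Complex.I * (p.2 : ℂ)‖ ^ 4
      = p.1 ^ 4 + 2 * (p.1 ^ 2 * p.2 ^ 2) + p.2 ^ 4 := fun p => by
    rw [show ‖(p.1 : ℂ) + Complex.I * (p.2 : ℂ)‖ ^ 4
      = (‖(p.1 : ℂ) + Complex.I * (p.2 : ℂ)‖ ^ 2) ^ 2 by ring, norm_sq_add_I_mul]
    ring
  simp only [h]
  have h2 := integrable_pow_gaussianReal 2
  have h4 := integrable_pow_gaussianReal 4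
  have h22 := h2.mul_prod h2
  have h42 : Integrable (fun p : ℝ × ℝ => p.1 ^ 4 + 2 * (p.1 ^ 2 * p.2 ^ 2))
      ((gaussianReal 0 1).prod (gaussianReal 0 1)) := (h4.comp_fst _).add (h22.const_mul 2)
  rw [integral_add h42 (h4.comp_snd _),
    integral_add (h4.comp_fst _) (h22.const_mul _), integral_fun_fst (fun x : ℝ => x ^ 4),
    integral_fun_snd (fun x : ℝ => x ^ 4), integral_const_mul,
    integral_prod_mul (fun x : ℝ => x ^ 2) (fun x : ℝ => x ^ 2), integral_sq_gaussianReal,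
    integral_pow_four_gaussianReal]
  norm_num

variable {ι : Type*} [Fintype ι]

theorem memLp_eval_complexGaussian (i : ι) {p : ℝ≥0∞} (hp : p ≠ ∞) :
    MemLp (fun z : ι → ℂ => z i) p (complexGaussian ι) :=
  (IsGaussian.memLp_id (stdGaussian ℂ) p hp).comp_measurePreserving (measurePreserving_eval _ i)

variable [DecidableEq ι]

/-- Multiplying one coordinate by a unimodular number preserves the standard complex Gaussian
law. -/
theorem measurePreserving_update_mul (a : ι) {θ : ℂ} (hθ : ‖θ‖ = 1) :
    MeasurePreserving (fun (z : ι → ℂ) i => (if i = a then θ else 1) * z i)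
      (complexGaussian ι) (complexGaussian ι) := by
  refine measurePreserving_complexGaussian
    { toFun := fun (z : ι → ℂ) i => (if i = a then θ else 1) * z i
      map_add' := fun z w => by ext i; simp [mul_add]
      map_smul' := fun c z => by ext i; simp [mul_left_comm] } (fun z => ?_)
  refine Finset.sum_congr rfl fun i _ => ?_
  simp only [LinearMap.coe_mk, AddHom.coe_mk, norm_mul]
  split_ifs <;> simp [hθ]

/-- A function that changes sign when one coordinate is multiplied by a unimodular number has mean
zero. -/
theorem integral_complexGaussian_eq_zero (f : (ι → ℂ) → ℂ) (hf : Continuous f) (a : ι) {θ c : ℂ}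
    (hθ : ‖θ‖ = 1) (hc : c ≠ 1)
    (h : ∀ z, f (fun i => (if i = a then θ else 1) * z i) = c * f z) :
    ∫ z, f z ∂(complexGaussian ι) = 0 := by
  have h1 := (measurePreserving_update_mul a hθ)
  have h2 : ∫ z, f z ∂(complexGaussian ι) = c * ∫ z, f z ∂(complexGaussian ι) := by
    conv_lhs => rw [← h1.map_eq]
    rw [integral_map h1.measurable.aemeasurable hf.aestronglyMeasurable]
    simp only [h, integral_const_mul]
  have h3 : (1 - c) * ∫ z, f z ∂(complexGaussian ι) = 0 := by linear_combination h2
  exact (mul_eq_zero.mp h3).resolve_left (sub_ne_zero.mpr hc.symm)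

theorem integral_norm_sq_mul_norm_sq_complexGaussian (a b : ι) :
    ∫ z : ι → ℂ, ‖z a‖ ^ 2 * ‖z b‖ ^ 2 ∂(complexGaussian ι) = if a = b then 8 else 4 := by
  have hev : ∀ (a : ι) (f : ℂ → ℝ), Continuous f →
      ∫ z : ι → ℂ, f (z a) ∂(complexGaussian ι) = ∫ z, f z ∂(stdGaussian ℂ) := fun a f hf => by
    have h := measurePreserving_eval (fun _ : ι => stdGaussian ℂ) a
    rw [← h.map_eq, integral_map h.measurable.aemeasurable hf.aestronglyMeasurable]
    rfl
  split_ifs with hab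
  · subst hab
    rw [← integral_norm_pow_four_stdGaussian, ← hev a (fun z => ‖z‖ ^ 4) (by fun_prop)]
    refine integral_congr_ae (Filter.Eventually.of_forall fun z => ?_)
    change ‖z a‖ ^ 2 * ‖z a‖ ^ 2 = ‖z a‖ ^ 4
    ring
  · have hind : iIndepFun (fun (i : ι) (z : ι → ℂ) => ‖z i‖ ^ 2) (complexGaussian ι) :=
      iIndepFun_pi (X := fun (_ : ι) (z : ℂ) => ‖z‖ ^ 2) (fun _ => by fun_prop)
    rw [(hind.indepFun hab).integral_fun_mul_eq_mul_integral
      (Continuous.aestronglyMeasurable (by fun_prop))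
      (Continuous.aestronglyMeasurable (by fun_prop)),
      hev a (fun z => ‖z‖ ^ 2) (by fun_prop), hev b (fun z => ‖z‖ ^ 2) (by fun_prop),
      integral_norm_sq_stdGaussian]
    norm_num

theorem integral_mul_conj_complexGaussian (a b : ι) :
    ∫ z : ι → ℂ, z a * star (z b) ∂(complexGaussian ι) = if a = b then 2 else 0 := by
  split_ifs with hab
  · subst hab
    have h := measurePreserving_eval (fun _ : ι => stdGaussian ℂ) a
    have h2 : ∫ z : ι → ℂ, ‖z a‖ ^ 2 ∂(complexGaussian ι) = 2 := by
      rw [← integral_norm_sq_stdGaussian, ← h.map_eq,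
        integral_map h.measurable.aemeasurable (by fun_prop)]
      rfl
    have h3 : ∀ z : ι → ℂ, z a * star (z a) = ((‖z a‖ ^ 2 : ℝ) : ℂ) := fun z => by
      rw [RCLike.star_def, Complex.mul_conj']
      simp
    simp only [h3]
    rw [integral_complex_ofReal, h2]
    simp
  · refine integral_complexGaussian_eq_zero _ (by fun_prop) a (θ := -1) (c := -1) (by simp)
      (by norm_num) (fun z => ?_)
    simp [Ne.symm hab]

end Moments

end RandomUnitary

section

attribute [local instance] Matrix.normedAddCommGroup Matrix.normedSpace

namespace RandomUnitary

/-! ### Moments of Gaussian matrices. -/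

section GaussianMatrixMoments

variable {N : ℕ}

theorem integral_gaussianMatrixLaw {E : Type*} [NormedAddCommGroup E] [NormedSpace ℝ E]
    [SecondCountableTopology E]
    {f : Matrix (Fin N) (Fin N) ℂ → E} (hf : Continuous f) :
    ∫ Y, f Y ∂(gaussianMatrixLaw N)
      = ∫ z, f (scaledMatrix N z) ∂(complexGaussian (Fin N × Fin N)) := by
  rw [gaussianMatrixLaw_eq_map, integral_map continuous_scaledMatrix.measurable.aemeasurable
    hf.aestronglyMeasurable]

theorem integrable_norm_rpow_gaussianMatrixLaw (N : ℕ) {r : ℝ} (hr : 0 < r) :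
    Integrable (fun Y : Matrix (Fin N) (Fin N) ℂ => ‖Y‖ ^ r) (gaussianMatrixLaw N) := by
  have h1 : MemLp (scaledMatrix N) (ENNReal.ofReal r) (complexGaussian (Fin N × Fin N)) :=
    MemLp.of_eval (E := fun _ => Fin N → ℂ) fun i => MemLp.of_eval fun j =>
      (memLp_eval_complexGaussian (i, j) (by simp)).const_mul _
  have h2 := h1.integrable_norm_rpow (by simpa using hr) (by simp)
  rw [ENNReal.toReal_ofReal hr.le] at h2
  rw [gaussianMatrixLaw_eq_map]
  refine (integrable_map_measure (Continuous.aestronglyMeasurable ?_)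
    continuous_scaledMatrix.measurable.aemeasurable).mpr h2
  exact (continuous_norm (E := Matrix (Fin N) (Fin N) ℂ)).rpow_const fun _ => Or.inr hr.le

theorem integrable_of_norm_le_mul_pow {E : Type*} [NormedAddCommGroup E]
    [SecondCountableTopology E] {f : Matrix (Fin N) (Fin N) ℂ → E} (hf : Continuous f) (C : ℝ)
    (k : ℕ) (hk : k ≠ 0) (h : ∀ Y, ‖f Y‖ ≤ C * ‖Y‖ ^ k) : Integrable f (gaussianMatrixLaw N) := by
  have h1 := (integrable_norm_rpow_gaussianMatrixLaw N (r := k) (by positivity)).const_mul C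
  refine h1.mono' hf.aestronglyMeasurable (Filter.Eventually.of_forall fun Y => ?_)
  simpa using h Y

theorem sq_inv_sqrt_two_mul (hN : 1 ≤ N) :
    ((((√(2 * (N : ℝ)))⁻¹ : ℝ) : ℂ)) ^ 2 = (2 * (N : ℂ))⁻¹ := by
  rw [← Complex.ofReal_pow, inv_pow, Real.sq_sqrt (by positivity)]
  push_cast
  rfl

theorem integral_entry_mul_conj_entry (hN : 1 ≤ N) (a b c d : Fin N) :
    ∫ Y : Matrix (Fin N) (Fin N) ℂ, Y a b * star (Y c d) ∂(gaussianMatrixLaw N)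
      = if a = c ∧ b = d then (N : ℂ)⁻¹ else 0 := by
  rw [integral_gaussianMatrixLaw (f := fun Y => Y a b * star (Y c d))
    ((continuous_id.matrix_elem a b).mul (continuous_id.matrix_elem c d).star)]
  have h : ∀ z : Fin N × Fin N → ℂ, scaledMatrix N z a b * star (scaledMatrix N z c d)
      = (2 * (N : ℂ))⁻¹ * (z (a, b) * star (z (c, d))) := fun z => by
    rw [← sq_inv_sqrt_two_mul hN]
    simp only [scaledMatrix, Matrix.of_apply, star_mul', RCLike.star_def, Complex.conj_ofReal]
    ring
  simp only [h]
  rw [integral_const_mul, integral_mul_conj_complexGaussian]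
  have hN' : (N : ℂ) ≠ 0 := by exact_mod_cast (by omega : N ≠ 0)
  simp only [Prod.mk.injEq]
  split_ifs
  · field_simp
  · simp

/-- Wick's formula for this pattern of indices: the two possible pairings of conjugated with
unconjugated entries force `i = j` or `k = l`. If neither holds, the entry `(k, i)` occurs exactly
once and its sign symmetry makes the mean vanish. -/
theorem integral_four_entries (hN : 1 ≤ N) (i j k l : Fin N) :
    ∫ Y : Matrix (Fin N) (Fin N) ℂ, (star (Y k i) * Y k j) * (star (Y l j) * Y l i)
      ∂(gaussianMatrixLaw N)
      = ((N : ℂ) ^ 2)⁻¹ * ((if i = j then 1 else 0) + (if k = l then 1 else 0)) := by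
  have hcont : Continuous fun Y : Matrix (Fin N) (Fin N) ℂ =>
      (star (Y k i) * Y k j) * (star (Y l j) * Y l i) :=
    ((continuous_id.matrix_elem k i).star.mul (continuous_id.matrix_elem k j)).mul
      ((continuous_id.matrix_elem l j).star.mul (continuous_id.matrix_elem l i))
  rw [integral_gaussianMatrixLaw hcont]
  have h : ∀ z : Fin N × Fin N → ℂ, (star (scaledMatrix N z k i) * scaledMatrix N z k j)
      * (star (scaledMatrix N z l j) * scaledMatrix N z l i)
      = ((2 * (N : ℂ))⁻¹) ^ 2 * ((star (z (k, i)) * z (k, j)) * (star (z (l, j)) * z (l, i))) :=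
    fun z => by
    rw [← sq_inv_sqrt_two_mul hN]
    simp only [scaledMatrix, Matrix.of_apply, star_mul', RCLike.star_def, Complex.conj_ofReal]
    ring
  simp only [h]
  rw [integral_const_mul]
  have hN' : (N : ℂ) ≠ 0 := by exact_mod_cast (by omega : N ≠ 0)
  have hreal : ∀ a b : Fin N × Fin N, ∫ z : Fin N × Fin N → ℂ,
      (star (z a) * z a) * (star (z b) * z b) ∂(complexGaussian (Fin N × Fin N))
      = if a = b then 8 else 4 := fun a b => by
    have h3 : ∀ z : Fin N × Fin N → ℂ, (star (z a) * z a) * (star (z b) * z b)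
        = ((‖z a‖ ^ 2 * ‖z b‖ ^ 2 : ℝ) : ℂ) := fun z => by
      rw [RCLike.star_def, Complex.conj_mul', Complex.conj_mul']
      simp
    simp only [h3]
    rw [integral_complex_ofReal, integral_norm_sq_mul_norm_sq_complexGaussian]
    split_ifs <;> simp
  rcases eq_or_ne i j with rfl | hij
  · rw [hreal]
    rcases eq_or_ne k l with rfl | hkl
    · simp; field_simp; norm_num
    · simp [hkl]; field_simp; norm_num
  · rcases eq_or_ne k l with rfl | hkl
    · have h4 : ∀ z : Fin N × Fin N → ℂ, (star (z (k, i)) * z (k, j)) * (star (z (k, j)) * z (k, i))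
          = (star (z (k, i)) * z (k, i)) * (star (z (k, j)) * z (k, j)) := fun z => by ring
      simp only [h4]
      rw [hreal]
      simp [hij]; field_simp; norm_num
    · rw [integral_complexGaussian_eq_zero _ (by fun_prop) (k, i) (θ := -1) (c := -1) (by simp)
        (by norm_num) (fun z => ?_)]
      · simp [hij, hkl]
      · simp [hij.symm, hkl.symm]

theorem integrable_two_entries (a b c d : Fin N) :
    Integrable (fun Y : Matrix (Fin N) (Fin N) ℂ => Y a b * star (Y c d)) (gaussianMatrixLaw N) := by
  refine integrable_of_norm_le_mul_pow
    ((continuous_id.matrix_elem a b).mul (continuous_id.matrix_elem c d).star) 1 2 (by norm_num)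
    (fun Y => ?_)
  have h : ∀ i j, ‖Y i j‖ ≤ ‖Y‖ := fun i j => Matrix.norm_entry_le_entrywise_sup_norm Y
  simp only [norm_mul, norm_star]
  calc ‖Y a b‖ * ‖Y c d‖ ≤ ‖Y‖ * ‖Y‖ := by gcongr <;> exact h _ _
    _ = 1 * ‖Y‖ ^ 2 := by ring

theorem integrable_four_entries (a b c d a' b' c' d' : Fin N) :
    Integrable (fun Y : Matrix (Fin N) (Fin N) ℂ => (star (Y a a') * Y b b')
      * (star (Y c c') * Y d d')) (gaussianMatrixLaw N) := by
  refine integrable_of_norm_le_mul_pow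
    (((continuous_id.matrix_elem a a').star.mul (continuous_id.matrix_elem b b')).mul
      ((continuous_id.matrix_elem c c').star.mul (continuous_id.matrix_elem d d'))) 1 4 (by norm_num)
    (fun Y => ?_)
  have h : ∀ i j, ‖Y i j‖ ≤ ‖Y‖ := fun i j => Matrix.norm_entry_le_entrywise_sup_norm Y
  simp only [norm_mul, norm_star]
  calc ‖Y a a'‖ * ‖Y b b'‖ * (‖Y c c'‖ * ‖Y d d'‖) ≤ ‖Y‖ * ‖Y‖ * (‖Y‖ * ‖Y‖) := by
        gcongr <;> exact h _ _
    _ = 1 * ‖Y‖ ^ 4 := by ring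

theorem integral_trace_sq (hN : 1 ≤ N) :
    ∫ Y : Matrix (Fin N) (Fin N) ℂ, Matrix.trace ((star Y * Y) * (star Y * Y))
      ∂(gaussianMatrixLaw N) = 2 * N := by
  have h : ∀ Y : Matrix (Fin N) (Fin N) ℂ, Matrix.trace ((star Y * Y) * (star Y * Y))
      = ∑ i, ∑ j, ∑ k, ∑ l, (star (Y k i) * Y k j) * (star (Y l j) * Y l i) := fun Y => by
    simp only [Matrix.trace, Matrix.diag_apply, Matrix.mul_apply, Matrix.star_apply,
      Finset.sum_mul_sum]
  simp only [h]
  have hi := fun i j k l => integrable_four_entries (N := N) k k l l i j j i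
  rw [integral_finsetSum _ fun i _ => integrable_finsetSum _ fun j _ =>
    integrable_finsetSum _ fun k _ => integrable_finsetSum _ fun l _ => hi i j k l]
  have h2 : ∀ i j : Fin N, ∫ Y : Matrix (Fin N) (Fin N) ℂ, ∑ k, ∑ l, (star (Y k i) * Y k j)
      * (star (Y l j) * Y l i) ∂(gaussianMatrixLaw N)
      = ∑ k : Fin N, ∑ l : Fin N, ((N : ℂ) ^ 2)⁻¹ * ((if i = j then 1 else 0) + (if k = l then 1 else 0)) := by
    intro i j
    rw [integral_finsetSum _ fun k _ => integrable_finsetSum _ fun l _ => hi i j k l]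
    refine Finset.sum_congr rfl fun k _ => ?_
    rw [integral_finsetSum _ fun l _ => hi i j k l]
    exact Finset.sum_congr rfl fun l _ => integral_four_entries hN i j k l
  have h3 : ∀ i, ∫ Y : Matrix (Fin N) (Fin N) ℂ, ∑ j, ∑ k, ∑ l, (star (Y k i) * Y k j)
      * (star (Y l j) * Y l i) ∂(gaussianMatrixLaw N)
      = ∑ j, ∑ k : Fin N, ∑ l : Fin N, ((N : ℂ) ^ 2)⁻¹ *
        ((if i = j then 1 else 0) + (if k = l then 1 else 0)) := by
    intro i
    rw [integral_finsetSum _ fun j _ => integrable_finsetSum _ fun k _ =>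
      integrable_finsetSum _ fun l _ => hi i j k l]
    exact Finset.sum_congr rfl fun j _ => h2 i j
  simp only [h3]
  have hN' : (N : ℂ) ≠ 0 := by exact_mod_cast (by omega : N ≠ 0)
  simp only [← Finset.mul_sum, Finset.sum_add_distrib, Finset.sum_ite_eq, Finset.mem_univ,
    if_true, Finset.sum_const, Finset.card_univ, Fintype.card_fin, nsmul_eq_mul, mul_one]
  field_simp
  ring

theorem integral_trace (hN : 1 ≤ N) :
    ∫ Y : Matrix (Fin N) (Fin N) ℂ, Matrix.trace (star Y * Y) ∂(gaussianMatrixLaw N) = N := by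
  have h : ∀ Y : Matrix (Fin N) (Fin N) ℂ, Matrix.trace (star Y * Y)
      = ∑ i, ∑ k, Y k i * star (Y k i) := fun Y => by
    simp only [Matrix.trace, Matrix.diag_apply, Matrix.mul_apply, Matrix.star_apply]
    simp only [mul_comm]
  have hi := fun i k => integrable_two_entries (N := N) k i k i
  simp only [h]
  rw [integral_finsetSum _ fun i _ => integrable_finsetSum _ fun k _ => hi i k]
  have h2 : ∀ i, ∫ Y : Matrix (Fin N) (Fin N) ℂ, ∑ k, Y k i * star (Y k i) ∂(gaussianMatrixLaw N)
      = 1 := fun i => by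
    rw [integral_finsetSum _ fun k _ => hi i k]
    simp only [integral_entry_mul_conj_entry hN]
    have hN' : (N : ℂ) ≠ 0 := by exact_mod_cast (by omega : N ≠ 0)
    simp [hN']
  rw [Finset.sum_congr rfl fun i _ => h2 i]
  simp

end GaussianMatrixMoments

end RandomUnitary

end

/-! ### The absolute value of a matrix. -/

section ContinuousAbs

open scoped MatrixOrder Matrix.Norms.L2Operator

/-- The operator norm supplies the C⋆-structure behind this, but the statement involves only the
topology, so it can be used together with the entrywise sup norm under which integrals are
estimated. -/
theorem Matrix.continuous_abs {m : Type*} [Fintype m] [DecidableEq m] :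
    Continuous (CFC.abs : Matrix m m ℂ → Matrix m m ℂ) :=
  CFC.continuous_abs

end ContinuousAbs

section Abs

open scoped MatrixOrder ComplexOrder

variable {m : Type*} [Fintype m] [DecidableEq m]

theorem Matrix.posSemidef_abs (Y : Matrix m m ℂ) : (CFC.abs Y).PosSemidef :=
  Matrix.nonneg_iff_posSemidef.mp (CFC.abs_nonneg Y)

theorem Matrix.star_abs (Y : Matrix m m ℂ) : star (CFC.abs Y) = CFC.abs Y :=
  (CFC.abs_nonneg Y).isSelfAdjoint.star_eq

theorem Matrix.abs_mul_abs (Y : Matrix m m ℂ) : CFC.abs Y * CFC.abs Y = star Y * Y :=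
  CFC.abs_mul_abs Y

/-- By uniqueness of the positive square root. -/
theorem Matrix.abs_conj_unitary {V : Matrix m m ℂ} (hV : V ∈ Matrix.unitaryGroup m ℂ)
    (Y : Matrix m m ℂ) : CFC.abs (V * Y * star V) = V * CFC.abs Y * star V := by
  have hV' := Matrix.mem_unitaryGroup_iff'.mp hV
  refine CFC.sqrt_unique ?_ (star_right_conjugate_nonneg (CFC.abs_nonneg Y) V)
  calc V * CFC.abs Y * star V * (V * CFC.abs Y * star V)
      = V * CFC.abs Y * (star V * V) * CFC.abs Y * star V := by simp only [mul_assoc]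
    _ = V * (CFC.abs Y * CFC.abs Y) * star V := by rw [hV']; simp only [mul_assoc, mul_one]
    _ = V * (star Y * (star V * V) * Y) * star V := by rw [hV', Matrix.abs_mul_abs, mul_one]
    _ = star (V * Y * star V) * (V * Y * star V) := by
        simp only [star_mul, star_star, mul_assoc]

/-- `t ≥ t² - (4/27) t⁴` for `t ≥ 0`, in the trace of `|Y|`. -/
theorem Matrix.trace_abs_ge (Y : Matrix m m ℂ) :
    (Matrix.trace (star Y * Y)).re - 4 / 27 * (Matrix.trace ((star Y * Y) * (star Y * Y))).re
      ≤ (Matrix.trace (CFC.abs Y)).re := by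
  have hM := Matrix.posSemidef_abs Y
  have hs := Matrix.star_abs Y
  have hMM := Matrix.abs_mul_abs Y
  set M := CFC.abs Y
  -- The scalar inequality is `t⁴ - (27/4) t² + (27/4) t = (t - 3/2)² (t² + 3t) ≥ 0`. For matrices,
  -- the square is split to the two sides of the positive factor `M² + 3M`.
  have hps : (M * M + (3 : ℝ) • M).PosSemidef := by
    refine Matrix.PosSemidef.add ?_ (hM.smul (by norm_num))
    have := Matrix.posSemidef_conjTranspose_mul_self M
    rwa [← Matrix.star_eq_conjTranspose, hs] at this
  have h2 := (hps.mul_mul_conjTranspose_same (M - (3 / 2 : ℝ) • 1)).trace_nonneg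
  rw [← Matrix.star_eq_conjTranspose, star_sub, hs, star_smul, star_one, star_trivial] at h2
  have h3 : (M - (3 / 2 : ℝ) • 1) * (M * M + (3 : ℝ) • M) * (M - (3 / 2 : ℝ) • 1)
      = (M * M) * (M * M) - (27 / 4 : ℝ) • (M * M) + (27 / 4 : ℝ) • M := by
    simp only [sub_mul, mul_sub, add_mul, mul_add, smul_mul_assoc, mul_smul_comm, one_mul, mul_one,
      mul_assoc]
    module
  rw [h3, Matrix.trace_add, Matrix.trace_sub, Matrix.trace_smul, Matrix.trace_smul, hMM] at h2
  have h4 := (Complex.le_def.mp h2).1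
  simp only [Complex.add_re, Complex.sub_re, Complex.smul_re, Complex.zero_re, smul_eq_mul] at h4
  linarith

end Abs

namespace RandomUnitary

/-! ### Haar unitaries and the polar decomposition of a Gaussian matrix. -/

section Haar

open scoped MatrixOrder

variable {N : ℕ}

instance : (haarUnitary N).IsHaarMeasure := by
  unfold haarUnitary; infer_instance

instance : IsProbabilityMeasure (haarUnitary N) := ⟨by
  simpa [haarUnitary] using Measure.haarMeasure_self
    (K₀ := (⊤ : TopologicalSpace.PositiveCompacts (Matrix.unitaryGroup (Fin N) ℂ)))⟩

/-- The image of Haar measure under a right translation is again a Haar probability measure, hence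
the same one by uniqueness. -/
theorem measurePreserving_mul_right_haarUnitary (g : Matrix.unitaryGroup (Fin N) ℂ) :
    MeasurePreserving (fun U => U * g) (haarUnitary N) (haarUnitary N) := by
  have hm : Measurable fun U : Matrix.unitaryGroup (Fin N) ℂ => U * g :=
    (continuous_mul_const g).measurable
  refine ⟨hm, ?_⟩
  have : IsProbabilityMeasure ((haarUnitary N).map fun U => U * g) :=
    Measure.isProbabilityMeasure_map hm.aemeasurable
  exact Measure.isHaarMeasure_eq_of_isProbabilityMeasure _ _

theorem continuous_unitary_mul_abs :
    Continuous fun p : Matrix.unitaryGroup (Fin N) ℂ × Matrix (Fin N) (Fin N) ℂ =>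
      p.1.1 * CFC.abs p.2 :=
  (continuous_subtype_val.comp continuous_fst).matrix_mul
    (Matrix.continuous_abs.comp continuous_snd)

instance : SecondCountableTopology (Matrix.unitaryGroup (Fin N) ℂ) :=
  inferInstanceAs (SecondCountableTopology
    ((Matrix.unitaryGroup (Fin N) ℂ : Set (Matrix (Fin N) (Fin N) ℂ))))

/-- If `U` is uniformly distributed and independent of the Gaussian matrix `Y`, then `U|Y|` has the
law of `Y`. -/
theorem measurePreserving_unitary_mul_abs :
    MeasurePreserving (fun p : Matrix.unitaryGroup (Fin N) ℂ × Matrix (Fin N) (Fin N) ℂ =>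
      p.1.1 * CFC.abs p.2) ((haarUnitary N).prod (gaussianMatrixLaw N)) (gaussianMatrixLaw N) := by
  have hm := (continuous_unitary_mul_abs (N := N)).measurable
  have hm' : Measurable fun p : Matrix.unitaryGroup (Fin N) ℂ × Matrix (Fin N) (Fin N) ℂ =>
      p.1.1 * p.2 :=
    ((continuous_subtype_val.comp continuous_fst).matrix_mul continuous_snd).measurable
  refine ⟨hm, Measure.ext fun s hs => ?_⟩
  rw [Measure.map_apply hm hs, Measure.prod_apply_symm (hm hs)]
  -- With `Y = w|Y|` fixed, right invariance replaces `U` by `U w` and `U|Y|` by `U Y`. Since `Y` is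
  -- frozen, `w` need not depend measurably on it. Afterwards `U` is frozen and the unitary
  -- invariance of the Gaussian law removes it.
  have h1 : ∀ Y : Matrix (Fin N) (Fin N) ℂ,
      haarUnitary N ((fun U => (U, Y)) ⁻¹' ((fun p => p.1.1 * CFC.abs p.2) ⁻¹' s))
      = haarUnitary N ((fun U => (U, Y)) ⁻¹' ((fun p => p.1.1 * p.2) ⁻¹' s)) := by
    intro Y
    obtain ⟨w, hw, hY⟩ := Matrix.exists_unitary_mul_abs Y
    have hms : MeasurableSet ((fun U : Matrix.unitaryGroup (Fin N) ℂ => (U, Y)) ⁻¹'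
        ((fun p => p.1.1 * CFC.abs p.2) ⁻¹' s)) := measurable_prodMk_right (hm hs)
    rw [← (measurePreserving_mul_right_haarUnitary ⟨w, hw⟩).measure_preimage hms.nullMeasurableSet]
    congr 1
    ext U
    simp only [Set.mem_preimage, Submonoid.coe_mul]
    rw [mul_assoc, ← hY]
  simp only [h1]
  rw [← Measure.prod_apply_symm (hm' hs), Measure.prod_apply (hm' hs)]
  have h2 : ∀ U : Matrix.unitaryGroup (Fin N) ℂ,
      gaussianMatrixLaw N (Prod.mk U ⁻¹' ((fun p => p.1.1 * p.2) ⁻¹' s))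
        = gaussianMatrixLaw N s := by
    intro U
    have h3 := (measurePreserving_unitary_mul U.2 (one_mem _)).measure_preimage
      hs.nullMeasurableSet
    simp only [mul_one] at h3
    exact h3
  simp [h2]

end Haar

end RandomUnitary

section

attribute [local instance] Matrix.normedAddCommGroup Matrix.normedSpace

namespace RandomUnitary

/-! ### Entrywise means of random matrices. -/

section EntrywiseIntegral

variable {Ω : Type*} [MeasurableSpace Ω] {κ : Type*} [Fintype κ]

/-- The entrywise integral of a random matrix. -/
def matrixIntegral (μ : Measure Ω) (X : Ω → Matrix κ κ ℂ) : Matrix κ κ ℂ :=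
  Matrix.of fun r s => ∫ ω, X ω r s ∂μ

theorem matrixIntegral_mul_mul {μ : Measure Ω} {X : Ω → Matrix κ κ ℂ}
    (hX : ∀ r s, Integrable (fun ω => X ω r s) μ) (A B : Matrix κ κ ℂ) :
    matrixIntegral μ (fun ω => A * X ω * B) = A * matrixIntegral μ X * B := by
  ext r s
  simp only [matrixIntegral, Matrix.of_apply, Matrix.mul_apply, Finset.sum_mul]
  rw [integral_finsetSum _ fun k _ => integrable_finsetSum _ fun l _ =>
    ((hX l k).const_mul _).mul_const _]
  refine Finset.sum_congr rfl fun k _ => ?_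
  rw [integral_finsetSum _ fun l _ => ((hX l k).const_mul _).mul_const _]
  refine Finset.sum_congr rfl fun l _ => ?_
  rw [integral_mul_const, integral_const_mul]

theorem trace_matrixIntegral {μ : Measure Ω} {X : Ω → Matrix κ κ ℂ}
    (hX : ∀ r s, Integrable (fun ω => X ω r s) μ) :
    Matrix.trace (matrixIntegral μ X) = ∫ ω, Matrix.trace (X ω) ∂μ := by
  simp only [Matrix.trace, Matrix.diag_apply, matrixIntegral, Matrix.of_apply]
  rw [integral_finsetSum _ fun k _ => hX k k]

end EntrywiseIntegral

/-! ### Algebra of `x ⊗ conj y` and of the projection `P`. -/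

section TensorConj

variable {N : ℕ}

theorem tensorConj_mul (x y x' y' : Matrix (Fin N) (Fin N) ℂ) :
    tensorConj (x * x') (y * y') = tensorConj x y * tensorConj x' y' := by
  have h : (y * y').map star = y.map star * y'.map star := by
    ext i j
    simp [Matrix.mul_apply]
  rw [tensorConj, tensorConj, tensorConj, h, Matrix.mul_kronecker_mul]

theorem tensorConj_apply (x y : Matrix (Fin N) (Fin N) ℂ) (r s : Fin N × Fin N) :
    tensorConj x y r s = x r.1 s.1 * star (y r.2 s.2) := rfl

theorem tensorConj_one : tensorConj (1 : Matrix (Fin N) (Fin N) ℂ) 1 = 1 := by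
  have h : (1 : Matrix (Fin N) (Fin N) ℂ).map star = 1 := by
    ext i j
    simp [Matrix.one_apply, apply_ite]
  rw [tensorConj, h, Matrix.one_kronecker_one]

theorem trace_tensorConj (x y : Matrix (Fin N) (Fin N) ℂ) :
    Matrix.trace (tensorConj x y) = x.trace * star y.trace := by
  simp only [Matrix.trace, Matrix.diag_apply, tensorConj_apply, Fintype.sum_prod_type, star_sum,
    Finset.sum_mul_sum]

theorem star_projId : star (projId N) = projId N := by
  simp [projId, Matrix.star_eq_conjTranspose, Matrix.conjTranspose_vecMulVec]

theorem dotProduct_idVec : star (idVec N) ⬝ᵥ idVec N = N := by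
  simp [dotProduct, idVec, Fintype.sum_prod_type, Matrix.one_apply, apply_ite]

theorem projId_mul_projId (hN : 1 ≤ N) : projId N * projId N = projId N := by
  have hN' : (N : ℂ) ≠ 0 := by exact_mod_cast (by omega : N ≠ 0)
  rw [projId, smul_mul_smul_comm, Matrix.vecMulVec_mul_vecMulVec, dotProduct_idVec,
    Matrix.vecMulVec_smul, smul_smul]
  congr 1
  field_simp

theorem trace_projId (hN : 1 ≤ N) : Matrix.trace (projId N) = 1 := by
  have hN' : (N : ℂ) ≠ 0 := by exact_mod_cast (by omega : N ≠ 0)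
  rw [projId, Matrix.trace_smul, Matrix.trace_vecMulVec, dotProduct_comm, dotProduct_idVec,
    smul_eq_mul, inv_mul_cancel₀ hN']

theorem trace_tensorConj_mul_projId (x y : Matrix (Fin N) (Fin N) ℂ) :
    Matrix.trace (tensorConj x y * projId N) = (N : ℂ)⁻¹ * Matrix.trace (x * star y) := by
  have h := tensorConj_mulVec x y 1
  rw [projId, mul_smul_comm, Matrix.trace_smul, Matrix.mul_vecMulVec, Matrix.trace_vecMulVec]
  have h2 : idVec N = fun r => (1 : Matrix (Fin N) (Fin N) ℂ) r.1 r.2 := rfl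
  nth_rewrite 1 [h2]
  rw [h, smul_eq_mul, mul_one]
  congr 1
  simp [dotProduct, idVec, Fintype.sum_prod_type, Matrix.one_apply, apply_ite, Matrix.trace,
    Matrix.star_eq_conjTranspose]

theorem mulVec_one_sub_projId (hN : 1 ≤ N) (ξ : Matrix (Fin N) (Fin N) ℂ) :
    ∃ η : Matrix (Fin N) (Fin N) ℂ, η.trace = 0 ∧
      (1 - projId N).mulVec (fun r => ξ r.1 r.2) = fun r => η r.1 r.2 := by
  refine ⟨ξ - ((N : ℂ)⁻¹ * ξ.trace) • 1, ?_, ?_⟩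
  · have hN' : (N : ℂ) ≠ 0 := by exact_mod_cast (by omega : N ≠ 0)
    simp only [Matrix.trace_sub, Matrix.trace_smul, Matrix.trace_one, Fintype.card_fin, smul_eq_mul]
    field_simp
    ring
  · rw [Matrix.sub_mulVec, Matrix.one_mulVec, projId_mulVec]
    rfl

end TensorConj

/-! ### The mean of `|Y| ⊗ conj |Y|` is a scalar, at least `1/4`, on the range of `1 - P`. -/

section MeanAbs

open scoped MatrixOrder ComplexOrder

variable {N : ℕ}

/-- `|Y|` and `Y` have the same Hilbert–Schmidt norm, which is at most `N` times the sup norm. This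
crude bound serves only integrability. -/
theorem norm_abs_entry_le (Y : Matrix (Fin N) (Fin N) ℂ) (i j : Fin N) :
    ‖CFC.abs Y i j‖ ≤ N * ‖Y‖ := by
  have h1 : ∑ i, ∑ j, ‖CFC.abs Y i j‖ ^ 2 = ∑ i, ∑ j, ‖Y i j‖ ^ 2 := by
    rw [sum_norm_sq_eq_trace, sum_norm_sq_eq_trace, Matrix.star_abs, Matrix.abs_mul_abs]
  have h2 : ‖CFC.abs Y i j‖ ^ 2 ≤ ∑ i, ∑ j, ‖CFC.abs Y i j‖ ^ 2 :=
    (Finset.single_le_sum (f := fun j => ‖CFC.abs Y i j‖ ^ 2) (fun _ _ => by positivity)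
      (Finset.mem_univ j)).trans
    (Finset.single_le_sum (f := fun i => ∑ j, ‖CFC.abs Y i j‖ ^ 2) (fun _ _ => by positivity)
      (Finset.mem_univ i))
  have h3 : ∑ i, ∑ j, ‖Y i j‖ ^ 2 ≤ ∑ _i : Fin N, ∑ _j : Fin N, ‖Y‖ ^ 2 := by
    gcongr with i _ j _
    exact Matrix.norm_entry_le_entrywise_sup_norm Y
  simp only [Finset.sum_const, Finset.card_univ, Fintype.card_fin, nsmul_eq_mul] at h3
  refine abs_le_of_sq_le_sq' ?_ (by positivity) |>.2
  nlinarith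

theorem continuous_tensorConj_abs (r s : Fin N × Fin N) :
    Continuous fun Y : Matrix (Fin N) (Fin N) ℂ => tensorConj (CFC.abs Y) (CFC.abs Y) r s :=
  (Matrix.continuous_abs.matrix_elem _ _).mul (Matrix.continuous_abs.matrix_elem _ _).star

theorem integrable_tensorConj_abs (r s : Fin N × Fin N) :
    Integrable (fun Y : Matrix (Fin N) (Fin N) ℂ => tensorConj (CFC.abs Y) (CFC.abs Y) r s)
      (gaussianMatrixLaw N) := by
  refine integrable_of_norm_le_mul_pow (continuous_tensorConj_abs r s) (N ^ 2) 2 (by norm_num)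
    fun Y => ?_
  rw [tensorConj_apply, norm_mul, norm_star]
  calc _ ≤ (N * ‖Y‖) * (N * ‖Y‖) := by
        gcongr <;> exact norm_abs_entry_le Y _ _
    _ = _ := by ring

/-- The mean of `|Y| ⊗ conj |Y|` for a Gaussian matrix `Y`. -/
def meanAbs (N : ℕ) : Matrix (Fin N × Fin N) (Fin N × Fin N) ℂ :=
  matrixIntegral (gaussianMatrixLaw N) fun Y => tensorConj (CFC.abs Y) (CFC.abs Y)

/-- `V Y V*` has the law of `Y`, and taking absolute values commutes with this conjugation. -/
theorem meanAbs_eq_conj {V : Matrix (Fin N) (Fin N) ℂ} (hV : V ∈ Matrix.unitaryGroup (Fin N) ℂ) :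
    meanAbs N = tensorConj V V * meanAbs N * tensorConj (star V) (star V) := by
  rw [meanAbs, ← matrixIntegral_mul_mul integrable_tensorConj_abs]
  ext r s
  simp only [matrixIntegral, Matrix.of_apply]
  have h := measurePreserving_unitary_mul hV (Unitary.star_mem hV)
  conv_lhs => rw [← h.map_eq]
  rw [integral_map h.measurable.aemeasurable (continuous_tensorConj_abs r s).aestronglyMeasurable]
  simp only [Matrix.abs_conj_unitary hV, tensorConj_mul]

theorem meanAbs_mul_tensorConj {V : Matrix (Fin N) (Fin N) ℂ}
    (hV : V ∈ Matrix.unitaryGroup (Fin N) ℂ) :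
    meanAbs N * tensorConj V V = tensorConj V V * meanAbs N := by
  conv_lhs => rw [meanAbs_eq_conj hV]
  rw [mul_assoc, ← tensorConj_mul, Matrix.mem_unitaryGroup_iff'.mp hV, tensorConj_one, mul_one]

/-- `ξ ↦ E |Y| ξ |Y|`. -/
def meanAbsMap (N : ℕ) : Matrix (Fin N) (Fin N) ℂ →ₗ[ℂ] Matrix (Fin N) (Fin N) ℂ where
  toFun ξ := Matrix.of fun i j => (meanAbs N).mulVec (fun r => ξ r.1 r.2) (i, j)
  map_add' ξ η := by
    have : (fun r : Fin N × Fin N => (ξ + η) r.1 r.2)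
        = (fun r => ξ r.1 r.2) + fun r => η r.1 r.2 := rfl
    rw [this, Matrix.mulVec_add]
    rfl
  map_smul' c ξ := by
    have : (fun r : Fin N × Fin N => (c • ξ) r.1 r.2) = c • fun r => ξ r.1 r.2 := rfl
    rw [this, Matrix.mulVec_smul]
    rfl

theorem mulVec_meanAbs (ξ : Matrix (Fin N) (Fin N) ℂ) :
    (meanAbs N).mulVec (fun r => ξ r.1 r.2) = fun r => meanAbsMap N ξ r.1 r.2 := rfl

theorem meanAbsMap_conj {V : Matrix (Fin N) (Fin N) ℂ}
    (hV : V ∈ Matrix.unitaryGroup (Fin N) ℂ) (ξ : Matrix (Fin N) (Fin N) ℂ) :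
    meanAbsMap N (V * ξ * star V) = V * meanAbsMap N ξ * star V := by
  have h1 : (meanAbs N).mulVec (fun r => (V * ξ * star V) r.1 r.2)
      = fun r => (V * meanAbsMap N ξ * star V) r.1 r.2 := by
    rw [Matrix.star_eq_conjTranspose, ← tensorConj_mulVec, Matrix.mulVec_mulVec,
      meanAbs_mul_tensorConj hV, ← Matrix.mulVec_mulVec, mulVec_meanAbs, tensorConj_mulVec]
  ext i j
  exact congrFun h1 (i, j)

/-- The Schur lemma applied to `ξ ↦ E |Y| ξ |Y|`: vectors in the range of `1 - P` are the matrices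
of trace zero. -/
theorem exists_meanAbs_mul_eq_smul (hN : 2 ≤ N) :
    ∃ c : ℂ, meanAbs N * (1 - projId N) = c • (1 - projId N) := by
  have : Nontrivial (Fin N) := Fin.nontrivial_iff_two_le.mpr hN
  obtain ⟨c, hc⟩ := Matrix.exists_scalar_on_traceless (Φ := meanAbsMap N)
    fun V hV ξ => meanAbsMap_conj hV ξ
  refine ⟨c, Matrix.ext_of_mulVec_single fun r => ?_⟩
  obtain ⟨η, hη, h⟩ := mulVec_one_sub_projId (by omega : 1 ≤ N)
    (Matrix.of fun i j => (Pi.single r (1 : ℂ) : Fin N × Fin N → ℂ) (i, j))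
  have h' : (1 - projId N).mulVec (Pi.single r 1) = fun r => η r.1 r.2 := h
  rw [← Matrix.mulVec_mulVec, Matrix.smul_mulVec, h', mulVec_meanAbs, hc η hη]
  rfl

theorem integrable_trace_abs_sq :
    Integrable (fun Y : Matrix (Fin N) (Fin N) ℂ => ‖Matrix.trace (CFC.abs Y)‖ ^ 2)
      (gaussianMatrixLaw N) := by
  refine integrable_of_norm_le_mul_pow (Matrix.continuous_abs.matrix_trace.norm.pow 2)
    (N ^ 4) 2 (by norm_num) fun Y => ?_
  have h : ‖Matrix.trace (CFC.abs Y)‖ ≤ N * (N * ‖Y‖) := by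
    refine (norm_sum_le _ _).trans ((Finset.sum_le_sum fun i _ => norm_abs_entry_le Y i i).trans ?_)
    simp
  rw [norm_pow, norm_norm]
  calc _ ≤ (N * (N * ‖Y‖)) ^ 2 := by gcongr
    _ = _ := by ring

/-- `Matrix.trace_abs_ge` and the two trace moments give `E tr |Y| ≥ N - (4/27) * 2N = (19/27) N =:
a`. The pointwise inequality `x² ≥ 2 a x - a²` then plays the role of Cauchy–Schwarz. -/
theorem le_integral_trace_abs_sq (hN : 1 ≤ N) : (19 / 27 * N : ℝ) ^ 2 ≤
    ∫ Y : Matrix (Fin N) (Fin N) ℂ, ‖Matrix.trace (CFC.abs Y)‖ ^ 2 ∂(gaussianMatrixLaw N) := by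
  have hN' : (N : ℂ) ≠ 0 := by exact_mod_cast (by omega : N ≠ 0)
  have h1 := integral_trace hN
  have h2 := integral_trace_sq hN
  have i1 : Integrable (fun Y : Matrix (Fin N) (Fin N) ℂ => Matrix.trace (star Y * Y))
      (gaussianMatrixLaw N) := Integrable.of_integral_ne_zero (by rw [h1]; exact hN')
  have i2 : Integrable (fun Y : Matrix (Fin N) (Fin N) ℂ =>
      Matrix.trace ((star Y * Y) * (star Y * Y)))
      (gaussianMatrixLaw N) := Integrable.of_integral_ne_zero (by rw [h2]; simpa using hN')
  have r1 : ∫ Y : Matrix (Fin N) (Fin N) ℂ, (Matrix.trace (star Y * Y)).re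
      ∂(gaussianMatrixLaw N) = N := by
    have := integral_re i1
    rw [h1] at this
    simpa using this
  have r2 : ∫ Y : Matrix (Fin N) (Fin N) ℂ, (Matrix.trace ((star Y * Y) * (star Y * Y))).re
      ∂(gaussianMatrixLaw N) = 2 * N := by
    have := integral_re i2
    rw [h2] at this
    simpa using this
  have j1 : Integrable (fun Y : Matrix (Fin N) (Fin N) ℂ => (Matrix.trace (star Y * Y)).re)
      (gaussianMatrixLaw N) := i1.re
  have j2 : Integrable (fun Y : Matrix (Fin N) (Fin N) ℂ =>
      4 / 27 * (Matrix.trace ((star Y * Y) * (star Y * Y))).re) (gaussianMatrixLaw N) :=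
    i2.re.const_mul _
  have hA := integral_sub j1 j2
  rw [integral_const_mul, r1, r2] at hA
  have j12 : Integrable (fun Y : Matrix (Fin N) (Fin N) ℂ => (Matrix.trace (star Y * Y)).re -
      4 / 27 * (Matrix.trace ((star Y * Y) * (star Y * Y))).re) (gaussianMatrixLaw N) := j1.sub j2
  have j3 := (j12.const_mul (2 * (19 / 27 * N : ℝ))).sub
    (integrable_const ((19 / 27 * N : ℝ) ^ 2))
  have hle := integral_mono j3 integrable_trace_abs_sq (fun Y => by
    have h3 := Matrix.trace_abs_ge Y
    have h4 : (Matrix.trace (CFC.abs Y)).re ^ 2 ≤ ‖Matrix.trace (CFC.abs Y)‖ ^ 2 := by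
      rw [sq_le_sq, abs_norm]
      exact Complex.abs_re_le_norm _
    have h5 := mul_le_mul_of_nonneg_left h3 (by positivity : (0 : ℝ) ≤ 2 * (19 / 27 * N : ℝ))
    simp only [Pi.sub_apply]
    nlinarith [sq_nonneg ((Matrix.trace (CFC.abs Y)).re - 19 / 27 * N)])
  refine le_trans (le_of_eq ?_) hle
  simp only [Pi.sub_apply]
  rw [integral_sub (j12.const_mul _) (integrable_const _), integral_const_mul, hA]
  simp
  ring

/-- The scalar is read off from traces. The full trace of the mean is `I = E |tr |Y||²`, its part on
`P` is `N⁻¹ E tr Y*Y = 1`, and `1 - P` has trace `N² - 1`. -/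
theorem exists_meanAbs_mul_eq_real_smul (hN : 2 ≤ N) :
    ∃ c : ℝ, 1 / 4 ≤ c ∧ meanAbs N * (1 - projId N) = (c : ℂ) • (1 - projId N) := by
  obtain ⟨c, hc⟩ := exists_meanAbs_mul_eq_smul hN
  have hN1 : 1 ≤ N := by omega
  have hN' : (N : ℂ) ≠ 0 := by exact_mod_cast (by omega : N ≠ 0)
  set I := ∫ Y : Matrix (Fin N) (Fin N) ℂ, ‖Matrix.trace (CFC.abs Y)‖ ^ 2 ∂(gaussianMatrixLaw N)
    with hI
  have h1 : Matrix.trace (meanAbs N) = (I : ℂ) := by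
    rw [meanAbs, trace_matrixIntegral integrable_tensorConj_abs, hI, ← integral_complex_ofReal]
    refine integral_congr_ae (Filter.Eventually.of_forall fun Y => ?_)
    simp only [trace_tensorConj]
    rw [RCLike.star_def, Complex.mul_conj']
    push_cast
    rfl
  have h2 : Matrix.trace (meanAbs N * projId N) = 1 := by
    have h := matrixIntegral_mul_mul (integrable_tensorConj_abs (N := N)) 1 (projId N)
    have hInt : ∀ r s, Integrable (fun Y : Matrix (Fin N) (Fin N) ℂ =>
        ((1 : Matrix (Fin N × Fin N) (Fin N × Fin N) ℂ) *
          tensorConj (CFC.abs Y) (CFC.abs Y) * projId N) r s) (gaussianMatrixLaw N) := by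
      intro r s
      simp only [one_mul, Matrix.mul_apply]
      exact integrable_finsetSum _ fun k _ => (integrable_tensorConj_abs r k).mul_const _
    rw [one_mul] at h
    rw [meanAbs, ← h, trace_matrixIntegral hInt]
    simp only [one_mul, trace_tensorConj_mul_projId, Matrix.star_abs, Matrix.abs_mul_abs]
    rw [integral_const_mul, integral_trace hN1, inv_mul_cancel₀ hN']
  have h3 := congrArg Matrix.trace hc
  rw [mul_sub, mul_one, Matrix.trace_sub, h1, h2, Matrix.trace_smul, Matrix.trace_sub,
    trace_projId hN1, Matrix.trace_one] at h3
  simp only [Fintype.card_prod, Fintype.card_fin, Nat.cast_mul, smul_eq_mul] at h3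
  have hNr : (2 : ℝ) ≤ N := by exact_mod_cast hN
  have hpos : (0 : ℝ) < N * N - 1 := by nlinarith
  have hne : ((N : ℂ) * N - 1) ≠ 0 := by exact_mod_cast hpos.ne'
  have hcr : c = (((I - 1) / (N * N - 1) : ℝ) : ℂ) := by
    push_cast
    rw [h3, mul_div_cancel_right₀ _ hne]
  refine ⟨(I - 1) / (N * N - 1), ?_, ?_⟩
  -- As `(19/27)² > 0.49`, the bound `I - 1 ≥ (N² - 1) / 4` already holds from `N = 2` on.
  · rw [le_div_iff₀ hpos]
    have := le_integral_trace_abs_sq hN1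
    rw [← hI] at this
    nlinarith
  · rw [← hcr, hc]

end MeanAbs

end RandomUnitary

end

section

/-! ### Jensen's inequality for powers of seminorms. -/

section Jensen

theorem Seminorm.continuous_of_finiteDimensional {E : Type*} [NormedAddCommGroup E]
    [NormedSpace ℝ E] [FiniteDimensional ℝ E] (F : Seminorm ℝ E) : Continuous F :=
  F.convexOn.locallyLipschitz.continuous

theorem Seminorm.convexOn_rpow {E : Type*} [AddCommGroup E] [Module ℝ E] (F : Seminorm ℝ E)
    {p : ℝ} (hp : 1 ≤ p) : ConvexOn ℝ Set.univ fun x => F x ^ p := by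
  refine ⟨convex_univ, fun x _ y _ a b ha hb hab => ?_⟩
  refine (Real.rpow_le_rpow (apply_nonneg F _) (F.convexOn.2 trivial trivial ha hb hab)
    (by linarith)).trans ?_
  exact (_root_.convexOn_rpow hp).2 (apply_nonneg F x) (apply_nonneg F y) ha hb hab

theorem Seminorm.rpow_integral_le {Ω : Type*} [MeasurableSpace Ω] {μ : Measure Ω}
    [IsProbabilityMeasure μ] {E : Type*} [NormedAddCommGroup E] [NormedSpace ℝ E]
    [FiniteDimensional ℝ E] (F : Seminorm ℝ E) {p : ℝ} (hp : 1 ≤ p) {X : Ω → E}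
    (hX : Integrable X μ) (hFX : Integrable (fun ω => F (X ω) ^ p) μ) :
    F (∫ ω, X ω ∂μ) ^ p ≤ ∫ ω, F (X ω) ^ p ∂μ :=
  have : CompleteSpace E := FiniteDimensional.complete ℝ E
  (F.convexOn_rpow hp).map_integral_le
    (F.continuous_of_finiteDimensional.rpow_const fun _ => Or.inr (by linarith)).continuousOn
    isClosed_univ (Filter.Eventually.of_forall fun _ => trivial) hX hFX

theorem Seminorm.rpow_add_le {E : Type*} [AddCommGroup E] [Module ℝ E] (F : Seminorm ℝ E)
    {p : ℝ} (hp : 1 ≤ p) (x y : E) : F (x + y) ^ p ≤ 2 ^ (p - 1) * (F x ^ p + F y ^ p) := by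
  refine (Real.rpow_le_rpow (apply_nonneg F _) (map_add_le_add F x y) (by linarith)).trans ?_
  have h := NNReal.rpow_add_le_mul_rpow_add_rpow ⟨F x, apply_nonneg F x⟩ ⟨F y, apply_nonneg F y⟩ hp
  exact_mod_cast h

end Jensen

attribute [local instance] Matrix.normedAddCommGroup Matrix.normedSpace

namespace RandomUnitary

/-! ### Seminorms on tuples of matrices. -/

section MatrixTuples

variable {n : ℕ} {κ : Type*} [Fintype κ]

theorem continuous_seminorm_matrix (F : Seminorm ℝ (Fin n → Matrix κ κ ℂ)) : Continuous F :=
  Seminorm.continuous_of_finiteDimensional (E := Fin n → κ → κ → ℂ) F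

theorem exists_seminorm_le (F : Seminorm ℝ (Fin n → Matrix κ κ ℂ)) :
    ∃ K : ℝ, 0 ≤ K ∧ ∀ (x : Fin n → Matrix κ κ ℂ) (t : ℝ), 0 ≤ t → (∀ j r s, ‖x j r s‖ ≤ t) →
      F x ≤ K * t := by
  obtain ⟨K, hK, h⟩ := Seminorm.bound_of_continuous_normedSpace (F := Fin n → κ → κ → ℂ) F
    (continuous_seminorm_matrix F)
  refine ⟨K, hK.le, fun x t ht hx => (h x).trans (mul_le_mul_of_nonneg_left ?_ hK.le)⟩
  exact (pi_norm_le_iff_of_nonneg ht).mpr fun j => (pi_norm_le_iff_of_nonneg ht).mpr fun r =>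
    (pi_norm_le_iff_of_nonneg ht).mpr fun s => hx j r s

theorem seminorm_entrywise_integral_rpow_le {Ω : Type*} [MeasurableSpace Ω] {μ : Measure Ω}
    [IsProbabilityMeasure μ] (F : Seminorm ℝ (Fin n → κ → κ → ℂ)) {p : ℝ} (hp : 1 ≤ p)
    {X : Ω → Fin n → κ → κ → ℂ} (hX : ∀ j r s, Integrable (fun ω => X ω j r s) μ)
    (hFX : Integrable (fun ω => F (X ω) ^ p) μ) :
    F (fun j r s => ∫ ω, X ω j r s ∂μ) ^ p ≤ ∫ ω, F (X ω) ^ p ∂μ := by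
  have hX2 : ∀ j r, Integrable (fun ω => X ω j r) μ := fun j r => Integrable.of_eval (hX j r)
  have hX1 : ∀ j, Integrable (fun ω => X ω j) μ := fun j => Integrable.of_eval (hX2 j)
  have h := Seminorm.rpow_integral_le F hp (Integrable.of_eval hX1) hFX
  have e : (∫ ω, X ω ∂μ) = fun j r s => ∫ ω, X ω j r s ∂μ := by
    funext j r s
    rw [eval_integral hX1, eval_integral (hX2 j), eval_integral (hX j r)]
  rwa [e] at h

theorem seminorm_matrixIntegral_rpow_le {Ω : Type*} [MeasurableSpace Ω] {μ : Measure Ω}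
    [IsProbabilityMeasure μ] (F : Seminorm ℝ (Fin n → Matrix κ κ ℂ)) {p : ℝ} (hp : 1 ≤ p)
    {X : Ω → Fin n → Matrix κ κ ℂ} (hX : ∀ j r s, Integrable (fun ω => X ω j r s) μ)
    (hFX : Integrable (fun ω => F (X ω) ^ p) μ) :
    F (fun j => matrixIntegral μ fun ω => X ω j) ^ p ≤ ∫ ω, F (X ω) ^ p ∂μ :=
  seminorm_entrywise_integral_rpow_le (n := n) (κ := κ) F hp hX hFX

end MatrixTuples

/-! ### Rotation invariance of a pair of independent Gaussian matrices. -/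

section Rotation

/-- The rotation `(x, y) ↦ ((x + y)/√2, (y - x)/√2)`. -/
def rotate {E : Type*} [AddCommGroup E] [Module ℝ E] (x : E × E) : E × E :=
  ((√2 / 2) • (x.1 + x.2), (√2 / 2) • (x.2 - x.1))

theorem measurePreserving_rotate_of_isGaussian {E : Type*} [NormedAddCommGroup E] [NormedSpace ℝ E]
    [CompleteSpace E] [SecondCountableTopology E] [MeasurableSpace E] [BorelSpace E]
    {μ : Measure E} [IsGaussian μ] (hμ : μ[id] = 0) :
    MeasurePreserving rotate (μ.prod μ) (μ.prod μ) := by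
  have h := IsGaussian.map_rotation_eq_self hμ (Real.pi / 4)
  have e : (rotate : E × E → E × E) = ContinuousLinearMap.rotation (Real.pi / 4) := by
    funext x
    rw [ContinuousLinearMap.rotation_apply, Real.cos_pi_div_four, Real.sin_pi_div_four, rotate]
    ext <;> simp only [] <;> module
  rw [e]
  exact ⟨(ContinuousLinearMap.continuous _).measurable, h⟩

/-- The rotation acts coordinatewise. This lemma is used twice: to pass from one complex Gaussian to
all entries of a matrix, and from one matrix to a tuple. -/
theorem measurePreserving_rotate_pi {ι E : Type*} [Fintype ι] [AddCommGroup E] [Module ℝ E]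
    [MeasurableSpace E] {μ : Measure E} [IsProbabilityMeasure μ]
    (h : MeasurePreserving rotate (μ.prod μ) (μ.prod μ)) :
    MeasurePreserving rotate ((Measure.pi fun _ : ι => μ).prod (Measure.pi fun _ : ι => μ))
      ((Measure.pi fun _ : ι => μ).prod (Measure.pi fun _ : ι => μ)) := by
  have h1 := measurePreserving_arrowProdEquivProdArrow E E ι (fun _ => μ) (fun _ => μ)
  have h2 := measurePreserving_pi (fun _ : ι => μ.prod μ) (fun _ => μ.prod μ) (fun _ => h)
  exact (h1.comp h2).comp h1.symm

theorem measurePreserving_rotate_map {E E' : Type*} [AddCommGroup E] [Module ℝ E]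
    [MeasurableSpace E] [AddCommGroup E'] [Module ℝ E'] [MeasurableSpace E'] {μ : Measure E}
    [IsProbabilityMeasure μ] {f : E → E'} (hf : Measurable f)
    (hadd : ∀ x y, f (x + y) = f x + f y) (hsub : ∀ x y, f (x - y) = f x - f y)
    (hsmul : ∀ (c : ℝ) x, f (c • x) = c • f x)
    (hrot : Measurable (rotate : E' × E' → E' × E'))
    (h : MeasurePreserving rotate (μ.prod μ) (μ.prod μ)) :
    MeasurePreserving rotate ((μ.map f).prod (μ.map f)) ((μ.map f).prod (μ.map f)) := by
  have hpm : IsProbabilityMeasure (μ.map f) := Measure.isProbabilityMeasure_map hf.aemeasurable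
  have hff : Measurable (Prod.map f f) := hf.prodMap hf
  have e : (rotate : E' × E' → E' × E') ∘ Prod.map f f = Prod.map f f ∘ rotate := by
    funext x
    simp only [rotate, Function.comp_apply, Prod.map, hsmul, hadd, hsub]
  refine ⟨hrot, ?_⟩
  rw [Measure.map_prod_map μ μ hf hf, Measure.map_map hrot hff, e,
    ← Measure.map_map hff h.measurable, h.map_eq]

theorem measurePreserving_rotate_gaussianMatrixLaw (N : ℕ) :
    MeasurePreserving rotate ((gaussianMatrixLaw N).prod (gaussianMatrixLaw N))
      ((gaussianMatrixLaw N).prod (gaussianMatrixLaw N)) := by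
  rw [gaussianMatrixLaw_eq_map]
  refine measurePreserving_rotate_map continuous_scaledMatrix.measurable ?_ ?_ ?_ ?_
    (measurePreserving_rotate_pi (measurePreserving_rotate_of_isGaussian ?_))
  · intro x y; ext i j; simp [scaledMatrix, mul_add]
  · intro x y; ext i j; simp [scaledMatrix, mul_sub]
  · intro c x; ext i j; simp [scaledMatrix, mul_left_comm]
  · refine Continuous.measurable ?_
    unfold rotate
    fun_prop
  · simp

end Rotation

/-! ### Laws of independent tuples and their integrability. -/

section Tuples

variable (N n : ℕ)

/-- The law of `n` independent Gaussian matrices. -/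
def gaussianTuple : Measure (Fin n → Matrix (Fin N) (Fin N) ℂ) :=
  Measure.pi fun _ => gaussianMatrixLaw N

/-- The law of `n` independent uniformly distributed unitary matrices. -/
def haarTuple : Measure (Fin n → Matrix.unitaryGroup (Fin N) ℂ) :=
  Measure.pi fun _ => haarUnitary N

instance : IsProbabilityMeasure (gaussianTuple N n) := by unfold gaussianTuple; infer_instance

instance : IsProbabilityMeasure (haarTuple N n) := by unfold haarTuple; infer_instance

variable {N n}

theorem measurePreserving_eval_gaussianTuple (j : Fin n) :
    MeasurePreserving (fun Y => Y j) (gaussianTuple N n) (gaussianMatrixLaw N) :=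
  measurePreserving_eval _ j

theorem matrixIntegral_gaussianTuple {f : Matrix (Fin N) (Fin N) ℂ →
    Matrix (Fin N × Fin N) (Fin N × Fin N) ℂ} (hf : ∀ r s, Continuous fun Y => f Y r s)
    (j : Fin n) : matrixIntegral (gaussianTuple N n) (fun Y => f (Y j))
      = matrixIntegral (gaussianMatrixLaw N) f := by
  ext r s
  have h := measurePreserving_eval_gaussianTuple (N := N) j
  simp only [matrixIntegral, Matrix.of_apply]
  rw [← h.map_eq, integral_map h.measurable.aemeasurable (hf r s).aestronglyMeasurable]

theorem measurePreserving_rotate_gaussianTuple :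
    MeasurePreserving rotate ((gaussianTuple N n).prod (gaussianTuple N n))
      ((gaussianTuple N n).prod (gaussianTuple N n)) :=
  measurePreserving_rotate_pi (measurePreserving_rotate_gaussianMatrixLaw N)

open scoped MatrixOrder in
theorem measurePreserving_haarTuple_mul_abs :
    MeasurePreserving (fun (p : (Fin n → Matrix.unitaryGroup (Fin N) ℂ) ×
      (Fin n → Matrix (Fin N) (Fin N) ℂ)) j => (p.1 j).1 * CFC.abs (p.2 j))
      ((haarTuple N n).prod (gaussianTuple N n)) (gaussianTuple N n) := by
  have h1 := measurePreserving_arrowProdEquivProdArrow (Matrix.unitaryGroup (Fin N) ℂ)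
    (Matrix (Fin N) (Fin N) ℂ) (Fin n) (fun _ => haarUnitary N) (fun _ => gaussianMatrixLaw N)
  have h2 := measurePreserving_pi (fun _ : Fin n => (haarUnitary N).prod (gaussianMatrixLaw N))
    (fun _ => gaussianMatrixLaw N) (fun _ => measurePreserving_unitary_mul_abs)
  exact h2.comp h1.symm

/-- The size of a tuple of matrices. -/
def tupleSize (Y : Fin n → Matrix (Fin N) (Fin N) ℂ) : ℝ := ∑ j, ‖Y j‖

theorem tupleSize_nonneg (Y : Fin n → Matrix (Fin N) (Fin N) ℂ) : 0 ≤ tupleSize Y :=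
  Finset.sum_nonneg fun _ _ => norm_nonneg _

theorem norm_entry_le_tupleSize (Y : Fin n → Matrix (Fin N) (Fin N) ℂ) (j : Fin n)
    (a b : Fin N) : ‖Y j a b‖ ≤ tupleSize Y :=
  (Matrix.norm_entry_le_entrywise_sup_norm (Y j)).trans
    (Finset.single_le_sum (f := fun j => ‖Y j‖) (fun _ _ => norm_nonneg _) (Finset.mem_univ j))

theorem continuous_tupleSize :
    Continuous (tupleSize : (Fin n → Matrix (Fin N) (Fin N) ℂ) → ℝ) :=
  continuous_finsetSum _ fun j _ =>
    (continuous_norm (E := Matrix (Fin N) (Fin N) ℂ)).comp (continuous_apply j)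

theorem integrable_tupleSize_rpow {r : ℝ} (hr : 1 ≤ r) :
    Integrable (fun Y => tupleSize Y ^ r) (gaussianTuple N n) := by
  have h1 : ∀ j, Integrable (fun Y : Fin n → Matrix (Fin N) (Fin N) ℂ => ‖Y j‖ ^ r)
      (gaussianTuple N n) := fun j =>
    (measurePreserving_eval_gaussianTuple j).integrable_comp_of_integrable
      (integrable_norm_rpow_gaussianMatrixLaw N (by linarith))
  have h2 := (integrable_finsetSum Finset.univ fun j _ => h1 j).const_mul
    ((Finset.univ : Finset (Fin n)).card ^ (r - 1) : ℝ)
  refine h2.mono' (continuous_tupleSize.rpow_const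
    fun _ => Or.inr (by linarith)).aestronglyMeasurable (Filter.Eventually.of_forall fun Y => ?_)
  rw [Real.norm_of_nonneg (Real.rpow_nonneg (tupleSize_nonneg Y) _)]
  have h3 := Real.rpow_sum_le_const_mul_sum_rpow Finset.univ (fun j => ‖Y j‖) hr
  simpa [tupleSize] using h3

end Tuples

end RandomUnitary

end

section

attribute [local instance] Matrix.normedAddCommGroup Matrix.normedSpace

namespace RandomUnitary

/-! ### Decoupling, and comparison of unitary with Gaussian tuples. -/

section Comparison

open scoped MatrixOrder

variable {N n : ℕ}

/-- The tuple of the `Y j ⊗ conj (Y' j)`. -/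
def tensorTuple (Y Y' : Fin n → Matrix (Fin N) (Fin N) ℂ) :
    Fin n → Matrix (Fin N × Fin N) (Fin N × Fin N) ℂ :=
  fun j => tensorConj (Y j) (Y' j)

/-- Right multiplication of all entries of a tuple by `1 - P`. -/
def compress (x : Fin n → Matrix (Fin N × Fin N) (Fin N × Fin N) ℂ) :
    Fin n → Matrix (Fin N × Fin N) (Fin N × Fin N) ℂ :=
  fun j => x j * (1 - projId N)

theorem continuous_tensorTuple : Continuous fun p : (Fin n → Matrix (Fin N) (Fin N) ℂ) ×
    (Fin n → Matrix (Fin N) (Fin N) ℂ) => tensorTuple p.1 p.2 := by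
  refine continuous_pi fun j => continuous_matrix fun r s => ?_
  exact (((continuous_apply j).comp continuous_fst).matrix_elem _ _).mul
    (((continuous_apply j).comp continuous_snd).matrix_elem _ _).star

theorem continuous_compress : Continuous
    (compress : (Fin n → Matrix (Fin N × Fin N) (Fin N × Fin N) ℂ) → _) :=
  continuous_pi fun j => (continuous_apply j).matrix_mul continuous_const

theorem norm_tensorTuple_le (Y Y' : Fin n → Matrix (Fin N) (Fin N) ℂ) (j : Fin n)
    (r s : Fin N × Fin N) : ‖tensorTuple Y Y' j r s‖ ≤ tupleSize Y * tupleSize Y' := by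
  rw [tensorTuple, tensorConj_apply, norm_mul, norm_star]
  exact mul_le_mul (norm_entry_le_tupleSize _ _ _ _) (norm_entry_le_tupleSize _ _ _ _)
    (norm_nonneg _) (tupleSize_nonneg _)

variable (F : Seminorm ℝ (Fin n → Matrix (Fin N × Fin N) (Fin N × Fin N) ℂ)) {p : ℝ}

theorem continuous_seminorm_rpow (hp : 1 ≤ p) : Continuous fun x => F x ^ p :=
  (continuous_seminorm_matrix F).rpow_const fun _ => Or.inr (by linarith)

theorem integrable_seminorm_tensorTuple (hp : 1 ≤ p) :
    Integrable (fun z : (Fin n → Matrix (Fin N) (Fin N) ℂ) × (Fin n → Matrix (Fin N) (Fin N) ℂ) =>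
      F (tensorTuple z.1 z.2) ^ p) ((gaussianTuple N n).prod (gaussianTuple N n)) := by
  obtain ⟨K, hK, h⟩ := exists_seminorm_le F
  have h1 := ((integrable_tupleSize_rpow (N := N) (n := n) hp).mul_prod
    (integrable_tupleSize_rpow (N := N) (n := n) hp)).const_mul (K ^ p)
  refine h1.mono' ((continuous_seminorm_rpow F hp).comp
    continuous_tensorTuple).aestronglyMeasurable (Filter.Eventually.of_forall fun z => ?_)
  rw [Real.norm_of_nonneg (Real.rpow_nonneg (apply_nonneg F _) _),
    ← Real.mul_rpow (tupleSize_nonneg _) (tupleSize_nonneg _),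
    ← Real.mul_rpow hK (mul_nonneg (tupleSize_nonneg _) (tupleSize_nonneg _))]
  exact Real.rpow_le_rpow (apply_nonneg F _) (h _ _ (mul_nonneg (tupleSize_nonneg _)
    (tupleSize_nonneg _)) (norm_tensorTuple_le _ _)) (by linarith)

theorem integrable_seminorm_tensorTuple_diag (hp : 1 ≤ p) :
    Integrable (fun Y => F (tensorTuple Y Y) ^ p) (gaussianTuple N n) := by
  obtain ⟨K, hK, h⟩ := exists_seminorm_le F
  have h1 := (integrable_tupleSize_rpow (N := N) (n := n)
    (by linarith : 1 ≤ 2 * p)).const_mul (K ^ p)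
  refine h1.mono' ((continuous_seminorm_rpow F hp).comp
    (continuous_tensorTuple.comp (continuous_id.prodMk continuous_id))).aestronglyMeasurable
    (Filter.Eventually.of_forall fun Y => ?_)
  rw [Real.norm_of_nonneg (Real.rpow_nonneg (apply_nonneg F _) _),
    Real.rpow_mul (tupleSize_nonneg _), ← Real.mul_rpow hK (Real.rpow_nonneg (tupleSize_nonneg _) _)]
  refine Real.rpow_le_rpow (apply_nonneg F _) ?_ (by linarith)
  rw [Real.rpow_two, sq]
  exact h _ _ (mul_nonneg (tupleSize_nonneg _) (tupleSize_nonneg _)) (norm_tensorTuple_le _ _)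

/-- Polarization: in the rotated variables the difference of squares is a sum of products. -/
theorem tensorTuple_rotate (z : (Fin n → Matrix (Fin N) (Fin N) ℂ) ×
    (Fin n → Matrix (Fin N) (Fin N) ℂ)) :
    tensorTuple (rotate z).1 (rotate z).1 - tensorTuple (rotate z).2 (rotate z).2
      = tensorTuple z.1 z.2 + tensorTuple z.2 z.1 := by
  funext j
  ext r s
  have h2 : ((√2 : ℝ) : ℂ) ^ 2 = 2 := by
    rw [← Complex.ofReal_pow, Real.sq_sqrt (by norm_num)]; norm_num
  simp only [Pi.sub_apply, Pi.add_apply, Matrix.sub_apply, Matrix.add_apply, tensorTuple,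
    tensorConj_apply, rotate, Pi.smul_apply, Matrix.smul_apply, Complex.real_smul, star_mul',
    star_add, star_sub, RCLike.star_def, Complex.conj_ofReal]
  push_cast
  linear_combination (z.1 j r.1 s.1 * (starRingEnd ℂ) (z.2 j r.2 s.2)
    + z.2 j r.1 s.1 * (starRingEnd ℂ) (z.1 j r.2 s.2)) / 2 * h2

/-- Convexity gives `2 ^ (p - 1)` times the sum of two moments, and these are equal because
exchanging the two independent tuples preserves the law. -/
theorem integrable_seminorm_add_swap (hp : 1 ≤ p) :
    Integrable (fun z : (Fin n → Matrix (Fin N) (Fin N) ℂ) × (Fin n → Matrix (Fin N) (Fin N) ℂ) =>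
      F (tensorTuple z.1 z.2 + tensorTuple z.2 z.1) ^ p)
      ((gaussianTuple N n).prod (gaussianTuple N n)) ∧
    ∫ z, F (tensorTuple z.1 z.2 + tensorTuple z.2 z.1) ^ p
        ∂((gaussianTuple N n).prod (gaussianTuple N n)) ≤
      2 ^ p * ∫ z, F (tensorTuple z.1 z.2) ^ p ∂((gaussianTuple N n).prod (gaussianTuple N n)) := by
  have h1 := integrable_seminorm_tensorTuple F hp
  have h2 := h1.swap
  have h3 := (h1.add h2).const_mul (2 ^ (p - 1))
  have hle : ∀ z : (Fin n → Matrix (Fin N) (Fin N) ℂ) × (Fin n → Matrix (Fin N) (Fin N) ℂ),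
      F (tensorTuple z.1 z.2 + tensorTuple z.2 z.1) ^ p
      ≤ 2 ^ (p - 1) * (F (tensorTuple z.1 z.2) ^ p + F (tensorTuple z.2 z.1) ^ p) := fun z =>
    F.rpow_add_le hp _ _
  have hInt : Integrable (fun z : (Fin n → Matrix (Fin N) (Fin N) ℂ) ×
      (Fin n → Matrix (Fin N) (Fin N) ℂ) => F (tensorTuple z.1 z.2 + tensorTuple z.2 z.1) ^ p)
      ((gaussianTuple N n).prod (gaussianTuple N n)) := by
    refine h3.mono' ((continuous_seminorm_rpow F hp).comp (continuous_tensorTuple.add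
      (continuous_tensorTuple.comp continuous_swap))).aestronglyMeasurable
      (Filter.Eventually.of_forall fun z => ?_)
    rw [Real.norm_of_nonneg (Real.rpow_nonneg (apply_nonneg F _) _)]
    exact hle z
  refine ⟨hInt, (integral_mono hInt h3 hle).trans (le_of_eq ?_)⟩
  have hswap : ∫ z : (Fin n → Matrix (Fin N) (Fin N) ℂ) × (Fin n → Matrix (Fin N) (Fin N) ℂ),
      F (tensorTuple z.2 z.1) ^ p ∂((gaussianTuple N n).prod (gaussianTuple N n))
      = ∫ z, F (tensorTuple z.1 z.2) ^ p ∂((gaussianTuple N n).prod (gaussianTuple N n)) :=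
    integral_prod_swap fun z : (Fin n → Matrix (Fin N) (Fin N) ℂ) ×
      (Fin n → Matrix (Fin N) (Fin N) ℂ) => F (tensorTuple z.1 z.2) ^ p
  rw [integral_const_mul]
  have hadd := integral_add h1 h2
  simp only [Function.comp_apply, Prod.fst_swap, Prod.snd_swap] at hadd
  rw [hswap] at hadd
  refine (congrArg (fun t => (2 : ℝ) ^ (p - 1) * t) hadd).trans ?_
  rw [← two_mul, ← mul_assoc, Real.rpow_sub_one (by norm_num)]
  ring

/-- Decoupling of the Gaussian chaos. -/
theorem integral_seminorm_sub_le (hp : 1 ≤ p) :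
    Integrable (fun z : (Fin n → Matrix (Fin N) (Fin N) ℂ) × (Fin n → Matrix (Fin N) (Fin N) ℂ) =>
      F (tensorTuple z.1 z.1 - tensorTuple z.2 z.2) ^ p)
      ((gaussianTuple N n).prod (gaussianTuple N n)) ∧
    ∫ z, F (tensorTuple z.1 z.1 - tensorTuple z.2 z.2) ^ p
        ∂((gaussianTuple N n).prod (gaussianTuple N n)) ≤
      2 ^ p * ∫ z, F (tensorTuple z.1 z.2) ^ p ∂((gaussianTuple N n).prod (gaussianTuple N n)) := by
  have hrot := measurePreserving_rotate_gaussianTuple (N := N) (n := n)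
  have hcont : Continuous fun z : (Fin n → Matrix (Fin N) (Fin N) ℂ) ×
      (Fin n → Matrix (Fin N) (Fin N) ℂ) =>
      F (tensorTuple z.1 z.1 - tensorTuple z.2 z.2) ^ p :=
    (continuous_seminorm_rpow F hp).comp
      ((continuous_tensorTuple.comp (continuous_fst.prodMk continuous_fst)).sub
        (continuous_tensorTuple.comp (continuous_snd.prodMk continuous_snd)))
  obtain ⟨h1, h2⟩ := integrable_seminorm_add_swap F hp
  have h3 := integrable_map_measure (μ := (gaussianTuple N n).prod (gaussianTuple N n))
    (f := rotate) hcont.aestronglyMeasurable hrot.measurable.aemeasurable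
  have h4 := integral_map (μ := (gaussianTuple N n).prod (gaussianTuple N n))
    (φ := rotate) hrot.measurable.aemeasurable hcont.aestronglyMeasurable
  rw [hrot.map_eq] at h3 h4
  simp only [tensorTuple_rotate] at h4
  refine ⟨h3.mpr ?_, h4 ▸ h2⟩
  simpa only [Function.comp_def, tensorTuple_rotate] using h1

/-- This is why `1 - P` appears: compression by it is exactly what removes the mean of the Gaussian
chaos. -/
theorem matrixIntegral_tensorConj_self (hN : 1 ≤ N) :
    matrixIntegral (gaussianMatrixLaw N) (fun Y => tensorConj Y Y) = projId N := by
  ext ⟨a, c⟩ ⟨b, d⟩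
  simp only [matrixIntegral, Matrix.of_apply, tensorConj_apply]
  rw [integral_entry_mul_conj_entry hN]
  simp only [projId, Matrix.smul_apply, Matrix.vecMulVec_apply, idVec, Pi.star_apply,
    Matrix.one_apply, smul_eq_mul]
  split_ifs <;> simp_all

variable {F}

theorem integrable_seminorm_compress_diag (hp : 1 ≤ p) (hF : ∀ x, F (compress x) ≤ F x) :
    Integrable (fun Y => F (compress (tensorTuple Y Y)) ^ p) (gaussianTuple N n) := by
  refine (integrable_seminorm_tensorTuple_diag F hp).mono' ((continuous_seminorm_rpow F hp).comp
    (continuous_compress.comp (continuous_tensorTuple.comp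
      (continuous_id.prodMk continuous_id)))).aestronglyMeasurable
    (Filter.Eventually.of_forall fun Y => ?_)
  rw [Real.norm_of_nonneg (Real.rpow_nonneg (apply_nonneg F _) _)]
  exact Real.rpow_le_rpow (apply_nonneg F _) (hF _) (by linarith)

/-- Subtracting an independent copy: for fixed `Y`, the mean over `Y'` of the compressed difference
is the compressed `Y ⊗ conj Y`, since `P (1 - P) = 0`. Jensen in `Y'` brings in the difference, the
hypothesis on `F` drops the compression, and decoupling finishes. -/
theorem integral_seminorm_compress_diag_le (hN : 1 ≤ N) (hp : 1 ≤ p)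
    (hF : ∀ x, F (compress x) ≤ F x) :
    ∫ Y, F (compress (tensorTuple Y Y)) ^ p ∂(gaussianTuple N n) ≤
      2 ^ p * ∫ z, F (tensorTuple z.1 z.2) ^ p ∂((gaussianTuple N n).prod (gaussianTuple N n)) := by
  obtain ⟨h1, h2⟩ := integral_seminorm_sub_le F hp (N := N) (n := n)
  refine le_trans ?_ h2
  have hcont : Continuous fun z : (Fin n → Matrix (Fin N) (Fin N) ℂ) ×
      (Fin n → Matrix (Fin N) (Fin N) ℂ) =>
      F (compress (tensorTuple z.1 z.1 - tensorTuple z.2 z.2)) ^ p :=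
    (continuous_seminorm_rpow F hp).comp (continuous_compress.comp
      ((continuous_tensorTuple.comp (continuous_fst.prodMk continuous_fst)).sub
        (continuous_tensorTuple.comp (continuous_snd.prodMk continuous_snd))))
  have hle : ∀ z : (Fin n → Matrix (Fin N) (Fin N) ℂ) × (Fin n → Matrix (Fin N) (Fin N) ℂ),
      F (compress (tensorTuple z.1 z.1 - tensorTuple z.2 z.2)) ^ p
        ≤ F (tensorTuple z.1 z.1 - tensorTuple z.2 z.2) ^ p := fun z =>
    Real.rpow_le_rpow (apply_nonneg F _) (hF _) (by linarith)
  have h3 : Integrable (fun z : (Fin n → Matrix (Fin N) (Fin N) ℂ) ×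
      (Fin n → Matrix (Fin N) (Fin N) ℂ) =>
      F (compress (tensorTuple z.1 z.1 - tensorTuple z.2 z.2)) ^ p)
      ((gaussianTuple N n).prod (gaussianTuple N n)) := by
    refine h1.mono' hcont.aestronglyMeasurable (Filter.Eventually.of_forall fun z => ?_)
    rw [Real.norm_of_nonneg (Real.rpow_nonneg (apply_nonneg F _) _)]
    exact hle z
  refine le_trans ?_ (integral_mono h3 h1 hle)
  rw [integral_prod _ h3]
  refine integral_mono_ae (integrable_seminorm_compress_diag hp hF) h3.integral_prod_left ?_
  filter_upwards [h3.prod_right_ae] with Y hY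
  have hpart : ∀ r s, Integrable (fun Y : Matrix (Fin N) (Fin N) ℂ => tensorConj Y Y r s)
      (gaussianMatrixLaw N) := fun r s => integrable_two_entries _ _ _ _
  have hpart' : ∀ (j : Fin n) r s, Integrable
      (fun Y' : Fin n → Matrix (Fin N) (Fin N) ℂ => tensorConj (Y' j) (Y' j) r s)
      (gaussianTuple N n) := fun j r s =>
    (measurePreserving_eval_gaussianTuple j).integrable_comp_of_integrable (hpart r s)
  have hdiff : ∀ (j : Fin n) r s, Integrable (fun Y' : Fin n → Matrix (Fin N) (Fin N) ℂ =>
      (tensorConj (Y j) (Y j) - tensorConj (Y' j) (Y' j)) r s) (gaussianTuple N n) :=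
    fun j r s => (integrable_const _).sub (hpart' j r s)
  have key : (fun j => matrixIntegral (gaussianTuple N n) fun Y' =>
      compress (tensorTuple Y Y - tensorTuple Y' Y') j) = compress (tensorTuple Y Y) := by
    funext j
    have e1 := matrixIntegral_mul_mul (hdiff j) 1 (1 - projId N)
    simp only [one_mul] at e1
    have e2 : matrixIntegral (gaussianTuple N n) (fun Y' =>
        tensorConj (Y j) (Y j) - tensorConj (Y' j) (Y' j))
        = tensorConj (Y j) (Y j) - projId N := by
      rw [← matrixIntegral_tensorConj_self hN, ← matrixIntegral_gaussianTuple (n := n)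
        (f := fun Y => tensorConj Y Y) (fun r s =>
          (continuous_id.matrix_elem _ _).mul (continuous_id.matrix_elem _ _).star) j]
      ext r s
      simp only [matrixIntegral, Matrix.of_apply, Matrix.sub_apply]
      rw [integral_sub (integrable_const _) (hpart' j r s)]
      simp
    refine e1.trans ?_
    rw [e2, sub_mul, mul_sub (projId N), mul_one, projId_mul_projId hN, sub_self, sub_zero]
    rfl
  have hJ := seminorm_matrixIntegral_rpow_le F hp (μ := gaussianTuple N n)
    (X := fun Y' => compress (tensorTuple Y Y - tensorTuple Y' Y')) (fun j r s => by
      simp only [compress, Matrix.mul_apply]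
      exact integrable_finsetSum _ fun k _ => (hdiff j r k).mul_const _) hY
  rw [key] at hJ
  exact hJ

theorem integrable_seminorm_haarTuple (hp : 1 ≤ p) :
    Integrable (fun U : Fin n → Matrix.unitaryGroup (Fin N) ℂ =>
      F (compress (tensorTuple (fun j => (U j).1) fun j => (U j).1)) ^ p) (haarTuple N n) := by
  have hcont : Continuous fun U : Fin n → Matrix.unitaryGroup (Fin N) ℂ =>
      F (compress (tensorTuple (fun j => (U j).1) fun j => (U j).1)) ^ p := by
    have h : Continuous fun U : Fin n → Matrix.unitaryGroup (Fin N) ℂ =>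
        fun j => (U j : Matrix (Fin N) (Fin N) ℂ) :=
      continuous_pi fun j => continuous_subtype_val.comp (continuous_apply j)
    exact (continuous_seminorm_rpow F hp).comp (continuous_compress.comp
      (continuous_tensorTuple.comp (h.prodMk h)))
  obtain ⟨C, hC⟩ := (isCompact_range hcont).isBounded.exists_norm_le
  exact Integrable.of_bound hcont.aestronglyMeasurable C
    (Filter.Eventually.of_forall fun U => hC _ ⟨U, rfl⟩)

/-- Write the Gaussian tuple in law as `U j * |Y j|` and apply Jensen in `Y` with `U` fixed. The
conditional mean is `c` times the compressed unitary tuple, because `U ⊗ conj U` factors out on the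
left and `hmean` evaluates the rest. -/
theorem mul_integral_seminorm_haarTuple_le (hp : 1 ≤ p) (hF : ∀ x, F (compress x) ≤ F x) {c : ℝ}
    (hc : 0 ≤ c) (hmean : meanAbs N * (1 - projId N) = (c : ℂ) • (1 - projId N)) :
    c ^ p * ∫ U : Fin n → Matrix.unitaryGroup (Fin N) ℂ,
      F (compress (tensorTuple (fun j => (U j).1) fun j => (U j).1)) ^ p ∂(haarTuple N n) ≤
    ∫ Y, F (compress (tensorTuple Y Y)) ^ p ∂(gaussianTuple N n) := by
  have hmp := measurePreserving_haarTuple_mul_abs (N := N) (n := n)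
  have hI := integrable_seminorm_compress_diag (N := N) (n := n) hp hF
  have hI' : Integrable (fun z : (Fin n → Matrix.unitaryGroup (Fin N) ℂ) ×
      (Fin n → Matrix (Fin N) (Fin N) ℂ) => F (compress (tensorTuple
        (fun j => (z.1 j).1 * CFC.abs (z.2 j)) fun j => (z.1 j).1 * CFC.abs (z.2 j))) ^ p)
      ((haarTuple N n).prod (gaussianTuple N n)) := hmp.integrable_comp_of_integrable hI
  have heq := integral_map (μ := (haarTuple N n).prod (gaussianTuple N n))
    hmp.measurable.aemeasurable (f := fun Y => F (compress (tensorTuple Y Y)) ^ p)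
    (by rw [hmp.map_eq]; exact hI.aestronglyMeasurable)
  rw [hmp.map_eq] at heq
  rw [heq, integral_prod _ hI', ← integral_const_mul]
  refine integral_mono_ae ((integrable_seminorm_haarTuple hp).const_mul _)
    hI'.integral_prod_left ?_
  filter_upwards [hI'.prod_right_ae] with U hU
  have hpart : ∀ (j : Fin n) r s, Integrable (fun Y : Fin n → Matrix (Fin N) (Fin N) ℂ =>
      tensorConj (CFC.abs (Y j)) (CFC.abs (Y j)) r s) (gaussianTuple N n) := fun j r s =>
    (measurePreserving_eval_gaussianTuple j).integrable_comp_of_integrable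
      (integrable_tensorConj_abs r s)
  have hX : ∀ (Y : Fin n → Matrix (Fin N) (Fin N) ℂ) (j : Fin n),
      compress (tensorTuple (fun j => (U j).1 * CFC.abs (Y j)) fun j => (U j).1 * CFC.abs (Y j)) j
      = tensorConj (U j).1 (U j).1 * tensorConj (CFC.abs (Y j)) (CFC.abs (Y j))
        * (1 - projId N) := fun Y j => by
    rw [compress, tensorTuple, tensorConj_mul]
  have key : (fun j => matrixIntegral (gaussianTuple N n) fun Y =>
      compress (tensorTuple (fun j => (U j).1 * CFC.abs (Y j)) fun j => (U j).1 * CFC.abs (Y j)) j)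
      = c • compress (tensorTuple (fun j => (U j).1) fun j => (U j).1) := by
    funext j
    simp only [hX]
    rw [matrixIntegral_mul_mul (hpart j), matrixIntegral_gaussianTuple
      (f := fun Y => tensorConj (CFC.abs Y) (CFC.abs Y)) continuous_tensorConj_abs, mul_assoc]
    change _ * (meanAbs N * _) = _
    rw [hmean, mul_smul_comm, Complex.coe_smul]
    rfl
  have hJ := seminorm_matrixIntegral_rpow_le F hp (μ := gaussianTuple N n)
    (X := fun Y => compress (tensorTuple (fun j => (U j).1 * CFC.abs (Y j))
      fun j => (U j).1 * CFC.abs (Y j))) (fun j r s => by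
      simp only [hX]
      simp only [Matrix.mul_apply]
      exact integrable_finsetSum _ fun k _ => (integrable_finsetSum _ fun l _ =>
        (hpart j l k).const_mul _).mul_const _) hU
  rw [key, map_smul_eq_mul, Real.norm_of_nonneg hc, Real.mul_rpow hc (apply_nonneg F _)] at hJ
  exact hJ

theorem projId_one : projId 1 = 1 := by
  ext r s
  obtain rfl : r = s := Subsingleton.elim _ _
  obtain rfl : r = (0, 0) := Subsingleton.elim _ _
  simp [projId, idVec, Matrix.vecMulVec_apply]

/-- The comparison of the two random tuples, in an arbitrary seminorm that decreases under
compression. -/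
theorem integral_seminorm_haarTuple_le (hN : 1 ≤ N) (hp : 1 ≤ p) (hF : ∀ x, F (compress x) ≤ F x) :
    ∫ U : Fin n → Matrix.unitaryGroup (Fin N) ℂ,
      F (compress (tensorTuple (fun j => (U j).1) fun j => (U j).1)) ^ p ∂(haarTuple N n) ≤
    8 ^ p * ∫ z, F (tensorTuple z.1 z.2) ^ p ∂((gaussianTuple N n).prod (gaussianTuple N n)) := by
  have hnonneg : 0 ≤ ∫ z : (Fin n → Matrix (Fin N) (Fin N) ℂ) ×
      (Fin n → Matrix (Fin N) (Fin N) ℂ), F (tensorTuple z.1 z.2) ^ p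
        ∂((gaussianTuple N n).prod (gaussianTuple N n)) :=
    integral_nonneg fun z => Real.rpow_nonneg (apply_nonneg F _) _
  -- For `N = 1` there are no nonzero trace-zero matrices: `P = 1` and the left side vanishes.
  rcases hN.eq_or_lt with rfl | hN2
  · have h0 : ∀ x : Fin n → Matrix (Fin 1 × Fin 1) (Fin 1 × Fin 1) ℂ, compress x = 0 := fun x => by
      funext j
      simp [compress, projId_one]
    simp only [h0, map_zero, Real.zero_rpow (by linarith : p ≠ 0), integral_zero]
    positivity
  · obtain ⟨c, hc, hmean⟩ := exists_meanAbs_mul_eq_real_smul (N := N) hN2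
    have h1 := mul_integral_seminorm_haarTuple_le (n := n) hp hF (by linarith) hmean
    have h2 := integral_seminorm_compress_diag_le (n := n) hN hp hF
    set A := ∫ U : Fin n → Matrix.unitaryGroup (Fin N) ℂ,
      F (compress (tensorTuple (fun j => (U j).1) fun j => (U j).1)) ^ p ∂(haarTuple N n)
    have hA : 0 ≤ A := integral_nonneg fun z => Real.rpow_nonneg (apply_nonneg F _) _
    have h3 : (1 / 4 : ℝ) ^ p * A ≤ c ^ p * A :=
      mul_le_mul_of_nonneg_right (Real.rpow_le_rpow (by norm_num) hc (by linarith)) hA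
    -- Multiplying by `4 ^ p` inverts the lower bound on `c`; with the decoupling factor, `4 ^ p * 2
    -- ^ p = 8 ^ p`.
    have h4 := mul_le_mul_of_nonneg_left (h3.trans (h1.trans h2))
      (by positivity : (0 : ℝ) ≤ 4 ^ p)
    rw [← mul_assoc, ← mul_assoc, ← Real.mul_rpow (by norm_num) (by norm_num),
      ← Real.mul_rpow (by norm_num) (by norm_num)] at h4
    norm_num at h4
    exact h4

end Comparison

end RandomUnitary

end

namespace RandomUnitary

/-! ### Transfer to random variables on an arbitrary probability space. -/

section RandomVariables

variable {N n : ℕ} {Ω : Type*} [MeasurableSpace Ω] {μ : Measure Ω}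

theorem hasLaw_haarTuple {U : Fin n → Ω → Matrix.unitaryGroup (Fin N) ℂ}
    (hU : ∀ j, HasLaw (U j) (haarUnitary N) μ) (hind : iIndepFun U μ) :
    HasLaw (fun ω j => U j ω) (haarTuple N n) μ :=
  hind.hasLaw_pi hU

theorem hasLaw_gaussianTuple_prod {Y Y' : Fin n → Ω → Matrix (Fin N) (Fin N) ℂ}
    (hY : ∀ j, HasLaw (Y j) (gaussianMatrixLaw N) μ)
    (hY' : ∀ j, HasLaw (Y' j) (gaussianMatrixLaw N) μ) (hind : iIndepFun (Sum.elim Y Y') μ) :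
    HasLaw (fun ω => (fun j => Y j ω, fun j => Y' j ω))
      ((gaussianTuple N n).prod (gaussianTuple N n)) μ := by
  have h1 : ∀ i, HasLaw (Sum.elim Y Y' i) (gaussianMatrixLaw N) μ := by
    rintro (j | j)
    exacts [hY j, hY' j]
  exact (measurePreserving_sumPiEquivProdPi
    fun _ : Fin n ⊕ Fin n => gaussianMatrixLaw N).comp_hasLaw (hind.hasLaw_pi h1)

variable {F : Seminorm ℝ (Fin n → Matrix (Fin N × Fin N) (Fin N × Fin N) ℂ)} {p : ℝ}

/-- The comparison of `U j ⊗ conj (U j) (1 - P)` with `Y j ⊗ conj (Y' j)`, for random variables on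
an arbitrary probability space. -/
theorem integral_seminorm_unitary_le (hN : 1 ≤ N)
    {U : Fin n → Ω → Matrix.unitaryGroup (Fin N) ℂ} {Y Y' : Fin n → Ω → Matrix (Fin N) (Fin N) ℂ}
    (hU : ∀ j, HasLaw (U j) (haarUnitary N) μ) (hindU : iIndepFun U μ)
    (hY : ∀ j, HasLaw (Y j) (gaussianMatrixLaw N) μ)
    (hY' : ∀ j, HasLaw (Y' j) (gaussianMatrixLaw N) μ) (hind : iIndepFun (Sum.elim Y Y') μ)
    (hp : 1 ≤ p) (hF : ∀ x, F (compress x) ≤ F x) :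
    Integrable (fun ω => F (fun j => tensorConj (U j ω).1 (U j ω).1 * (1 - projId N)) ^ p) μ ∧
    Integrable (fun ω => F (fun j => tensorConj (Y j ω) (Y' j ω)) ^ p) μ ∧
    ∫ ω, F (fun j => tensorConj (U j ω).1 (U j ω).1 * (1 - projId N)) ^ p ∂μ ≤
      8 ^ p * ∫ ω, F (fun j => tensorConj (Y j ω) (Y' j ω)) ^ p ∂μ := by
  have lU := hasLaw_haarTuple hU hindU
  have lY := hasLaw_gaussianTuple_prod hY hY' hind
  have iU := integrable_seminorm_haarTuple (F := F) hp
  have iY := integrable_seminorm_tensorTuple F hp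
  have eU := lU.integral_comp iU.aestronglyMeasurable
  have eY := lY.integral_comp iY.aestronglyMeasurable
  have main := integral_seminorm_haarTuple_le (n := n) hN hp hF
  rw [← eU, ← eY] at main
  rw [← lU.map_eq] at iU
  rw [← lY.map_eq] at iY
  exact ⟨iU.comp_aemeasurable lU.aemeasurable, iY.comp_aemeasurable lY.aemeasurable, main⟩

end RandomVariables

/-! ### Scalar and matrix coefficients. -/

section Coefficients

variable {N n k : ℕ} {q : ℝ≥0∞}

/-- `x ↦ ∑ j, a j • x j` for scalar coefficients. -/
def scalarCombination (a : Fin n → ℂ) :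
    (Fin n → Matrix (Fin N × Fin N) (Fin N × Fin N) ℂ) →ₗ[ℝ]
      Matrix (Fin N × Fin N) (Fin N × Fin N) ℂ where
  toFun x := ∑ j, a j • x j
  map_add' x y := by simp [smul_add, Finset.sum_add_distrib]
  map_smul' c x := by
    simp only [Pi.smul_apply, RingHom.id_apply, Finset.smul_sum]
    exact Finset.sum_congr rfl fun j _ => smul_comm _ _ _

/-- `x ↦ ∑ j, a j ⊗ x j` for matrix coefficients. -/
def matrixCombination (a : Fin n → Matrix (Fin k) (Fin k) ℂ) :
    (Fin n → Matrix (Fin N × Fin N) (Fin N × Fin N) ℂ) →ₗ[ℝ]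
      Matrix (Fin k × Fin N × Fin N) (Fin k × Fin N × Fin N) ℂ where
  toFun x := ∑ j, a j ⊗ₖ x j
  map_add' x y := by simp [Matrix.kronecker_add, Finset.sum_add_distrib]
  map_smul' c x := by
    simp only [Pi.smul_apply, RingHom.id_apply, Finset.smul_sum, Matrix.kronecker_smul]

theorem star_one_sub_projId : star (1 - projId N) = 1 - projId N := by
  rw [star_sub, star_one, star_projId]

theorem one_sub_projId_mul_self (hN : 1 ≤ N) :
    (1 - projId N) * (1 - projId N) = 1 - projId N := by
  rw [sub_mul, one_mul, mul_sub, mul_one, projId_mul_projId hN, sub_self, sub_zero]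

theorem schattenNorm_scalarCombination_compress_le (hN : 1 ≤ N) (hq : 1 ≤ q) (a : Fin n → ℂ)
    (x : Fin n → Matrix (Fin N × Fin N) (Fin N × Fin N) ℂ) :
    schattenNorm q (scalarCombination a (compress x)) ≤
      schattenNorm q (scalarCombination a x) := by
  have h : scalarCombination a (compress x) = scalarCombination a x * (1 - projId N) := by
    simp only [scalarCombination, compress, LinearMap.coe_mk, AddHom.coe_mk, Finset.sum_mul,
      smul_mul_assoc]
  rw [h]
  exact schattenNorm_mul_projection_le hq _ star_one_sub_projId (one_sub_projId_mul_self hN)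

/-- Compressing every entry amounts to multiplying the whole sum on the right by the projection `1 ⊗
(1 - P)`, whatever the size `k`. The constant is therefore independent of `k`. -/
theorem schattenNorm_matrixCombination_compress_le (hN : 1 ≤ N) (hq : 1 ≤ q)
    (a : Fin n → Matrix (Fin k) (Fin k) ℂ)
    (x : Fin n → Matrix (Fin N × Fin N) (Fin N × Fin N) ℂ) :
    schattenNorm q (matrixCombination a (compress x)) ≤
      schattenNorm q (matrixCombination a x) := by
  have h : matrixCombination a (compress x) =
      matrixCombination a x * ((1 : Matrix (Fin k) (Fin k) ℂ) ⊗ₖ (1 - projId N)) := by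
    simp only [matrixCombination, compress, LinearMap.coe_mk, AddHom.coe_mk, Finset.sum_mul,
      ← Matrix.mul_kronecker_mul, mul_one]
  rw [h]
  refine schattenNorm_mul_projection_le hq _ ?_ ?_
  · rw [Matrix.star_eq_conjTranspose, Matrix.conjTranspose_kronecker, Matrix.conjTranspose_one,
      ← Matrix.star_eq_conjTranspose, star_one_sub_projId]
  · rw [← Matrix.mul_kronecker_mul, one_mul, one_sub_projId_mul_self hN]

end Coefficients

end RandomUnitary

end

theorem mainTheorem5 :
    ∃ C : ℝ, 0 < C ∧
      ∀ (N n : ℕ), 1 ≤ N →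
      ∀ {Ω : Type*} [MeasurableSpace Ω] (μ : Measure Ω) [IsProbabilityMeasure μ]
        (U : Fin n → Ω → Matrix.unitaryGroup (Fin N) ℂ)
        (Y Y' : Fin n → Ω → Matrix (Fin N) (Fin N) ℂ),
        -- the `U j` are i.i.d. and uniformly distributed on the unitary group
        (∀ j, HasLaw (U j) (haarUnitary N) μ) → iIndepFun U μ →
        -- the `Y j` and `Y' j` are, all together, i.i.d. Gaussian matrices
        (∀ j, HasLaw (Y j) (gaussianMatrixLaw N) μ) →
        (∀ j, HasLaw (Y' j) (gaussianMatrixLaw N) μ) →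
        iIndepFun (Sum.elim Y Y') μ →
        ∀ (p : ℝ) (q : ℝ≥0∞), 1 ≤ p → 1 ≤ q →
          -- scalar coefficients
          (∀ a : Fin n → ℂ,
            Integrable (fun ω => schattenNorm q
              (∑ j, a j • (tensorConj (U j ω).1 (U j ω).1 * (1 - projId N))) ^ p) μ ∧
            Integrable (fun ω => schattenNorm q
              (∑ j, a j • tensorConj (Y j ω) (Y' j ω)) ^ p) μ ∧
            ∫ ω, schattenNorm q
                (∑ j, a j • (tensorConj (U j ω).1 (U j ω).1 * (1 - projId N))) ^ p ∂μ ≤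
              C ^ p * ∫ ω, schattenNorm q
                (∑ j, a j • tensorConj (Y j ω) (Y' j ω)) ^ p ∂μ) ∧
          -- matrix coefficients
          (∀ (k : ℕ) (a : Fin n → Matrix (Fin k) (Fin k) ℂ),
            Integrable (fun ω => schattenNorm q
              (∑ j, a j ⊗ₖ (tensorConj (U j ω).1 (U j ω).1 * (1 - projId N))) ^ p) μ ∧
            Integrable (fun ω => schattenNorm q
              (∑ j, a j ⊗ₖ tensorConj (Y j ω) (Y' j ω)) ^ p) μ ∧
            ∫ ω, schattenNorm q
                (∑ j, a j ⊗ₖ (tensorConj (U j ω).1 (U j ω).1 * (1 - projId N))) ^ p ∂μ ≤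
              C ^ p * ∫ ω, schattenNorm q
                (∑ j, a j ⊗ₖ tensorConj (Y j ω) (Y' j ω)) ^ p ∂μ) := by
  refine ⟨8, by norm_num, ?_⟩
  intro N n hN Ω _ μ _ U Y Y' hU hindU hY hY' hind p q hp hq
  refine ⟨fun a => ?_, fun k a => ?_⟩
  -- The coefficients enter only through the choice of the seminorm: a Schatten norm composed with a
  -- linear map of the tuple.
  · exact integral_seminorm_unitary_le
      (F := (schattenSeminorm (Fin N × Fin N) hq).comp (scalarCombination a))
      hN hU hindU hY hY' hind hp (schattenNorm_scalarCombination_compress_le hN hq a)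
  · exact integral_seminorm_unitary_le
      (F := (schattenSeminorm (Fin k × Fin N × Fin N) hq).comp (matrixCombination a))
      hN hU hindU hY hY' hind hp (schattenNorm_matrixCombination_compress_le hN hq a)
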